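/- Let $M$ be a compact smooth $n$-dimensional Riemannian manifold without boundary, with volume measure $dx$, and let $\mathcal P_+(M)$ be the set of smooth strictly positive probability densities on $M$. Let $D\subseteq C^\infty(M)$ be an open set that contains all strictly positive smooth functions, and let $\mathcal F\colon D\to\mathbb R$ be a smooth functional with a smooth first variation ($L^2$ gradient) $\delta\mathcal F\colon D\to C^\infty(M)$ which is injective, with inverse $(\delta\mathcal F)^{-1}$ on its image. Let $a>0$, $b,\lambda\in\mathbb R$, and assume: - $\mathcal F$ is $a$-homogeneous: $\mathcal F(\rho)=a^{-1}\int\delta\mathcal F(\rho)\,\rho\,dx+b$ for all $\rho\in\mathcal P_+(M)$; - $\mathcal F$ is $\lambda$-convex in the Wasserstein density manifold: for all $\rho\in\mathcal P_+(M)$ and $\Phi\in C^\infty(M)$, with $V=-\operatorname{div}(\rho\nabla\Phi)$, $$\operatorname{Hess}_W\mathcal F(\rho)(V,V)=\delta^2\mathcal F(\rho)(V,V)+\int\nabla^2\big(\delta\mathcal F(\rho)\big)(\nabla\Phi,\nabla\Phi)\,\rho\,dx\;\ge\;\lambda\int|\nabla\Phi|^2\rho\,dx .$$ Let $\mathcal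 H(\rho,S)=\frac12\int|\nabla S|^2\rho\,dx-\frac12\int|\nabla\delta\mathcal F(\rho)|^2\rho\,dx$ and let $(\rho_t,S_t)_{t\in[0,1]}$, with $\rho_t\in\mathcal P_+(M)$, be a smooth solution of the generalized Schrödinger bridge Hamiltonian flow $\partial_t\rho_t=\partial_S\mathcal H(\rho_t,S_t)$, $\partial_tS_t=-\partial_\rho\mathcal H(\rho_t,S_t)$, where $\partial_S,\partial_\rho$ are $L^2$ gradients. Let $\eta_t,\eta_t^*\in D$ be the Hopf--Cole variables, i.e. $\delta\mathcal F(\rho_t)=\delta\mathcal F(\eta_t)+\delta\mathcal F(\eta^*_t)$ and $S_t=\delta\mathcal F(\eta_t)-\delta\mathcal F(\eta_t^*)$, and set $$\mathcal G(\eta,\eta^*)=a^{-1}\!\int(\delta\mathcal F)^{-1}\big(\delta\mathcal F(\eta)+\delta\mathcal F(\eta^*)\big)\,\delta\mathcal F(\eta)\,dx+\tfrac b2,\qquad \mathcal G^*(\eta,\eta^*)=a^{-1}\!\int(\delta\mathcal F)^{-1}\big(\delta\mathcal F(\eta)+\delta\mathcal F(\eta^*)\big)\,\delta\mathcal F(\eta^*)\,dx+\tfrac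 b2 .$$ Put $c=\frac{1-a^{-1}}2$ and $\alpha_t=\frac{1-e^{-2\lambda t}}{1-e^{-2\lambda}}$, with $\alpha_t=t$ if $\lambda=0$. Then $\mathcal H=\mathcal H(\rho_t,S_t)$ is independent of $t\in[0,1]$, and for all $t\in[0,1]$ one has $\mathcal F(\rho_t)=\mathcal G(\eta_t,\eta_t^*)+\mathcal G^*(\eta_t,\eta_t^*)$ and $$\mathcal G(\eta_t,\eta^*_t)+ct\mathcal H\le\alpha_{1-t}\,\mathcal G(\eta_0,\eta_0^*)+(1-\alpha_{1-t})\big(\mathcal G(\eta_1,\eta^*_1)+c\mathcal H\big),$$ $$\mathcal G^*(\eta_t,\eta^*_t)-ct\mathcal H\le(1-\alpha_t)\,\mathcal G^*(\eta_0,\eta_0^*)+\alpha_t\big(\mathcal G^*(\eta_1,\eta^*_1)-c\mathcal H\big).$$ -/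

import Mathlib

open scoped Manifold ContDiff InnerProductSpace Topology
open MeasureTheory Set Bundle

noncomputable section

namespace HopfCole

variable {n : ℕ} {M : Type*} [TopologicalSpace M] [ChartedSpace (EuclideanSpace ℝ (Fin n)) M]

/-! ### Calculus on the base Riemannian manifold -/

variable (n M) in
/-- The space `C^∞(M)` of smooth real functions on the `n`-dimensional manifold `M`. -/
abbrev SmoothFn : Type _ := C^∞⟮𝓡 n, M; 𝓘(ℝ, ℝ), ℝ⟯

section Riemannian

variable [RiemannianBundle (fun x : M => TangentSpace (𝓡 n) x)]

/-- The Riemannian gradient `∇f` at `x`: the Riesz representative of the differential of `f`. -/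
def grad (f : M → ℝ) (x : M) : TangentSpace (𝓡 n) x :=
  haveI : FiniteDimensional ℝ (TangentSpace (𝓡 n) x) :=
    inferInstanceAs (FiniteDimensional ℝ (EuclideanSpace ℝ (Fin n)))
  haveI : CompleteSpace (TangentSpace (𝓡 n) x) := FiniteDimensional.complete ℝ _
  (InnerProductSpace.toDual ℝ (TangentSpace (𝓡 n) x)).symm (mvfderiv (𝓡 n) f x)

variable (n) in
/-- The function `(∇f, ∇h)` on `M`. -/
def gradInner (f h : M → ℝ) (x : M) : ℝ :=
  ⟪(grad f x : TangentSpace (𝓡 n) x), grad h x⟫_ℝ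

variable (n) in
/-- The Hessian `∇²f (∇φ, ∇φ)` of `f` in the direction of a gradient field. Since the Levi-Civita
connection `D` is metric and torsion free, `D_{∇φ} ∇φ = ½ ∇|∇φ|²`, so that
`∇²f (∇φ, ∇φ) = ∇φ · (∇f, ∇φ) - (∇f, D_{∇φ} ∇φ) = (∇φ, ∇(∇f, ∇φ)) - ½ (∇f, ∇|∇φ|²)`. -/
def hessGrad (f φ : M → ℝ) (x : M) : ℝ :=
  gradInner n φ (gradInner n f φ) x - 1 / 2 * gradInner n f (gradInner n φ φ) x

/-- The Gram matrix `g_ij` of the metric in the chart at `x₀`, at the point with coordinates `y`. -/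
def gramMatrix (x₀ : M) (y : EuclideanSpace ℝ (Fin n)) : Matrix (Fin n) (Fin n) ℝ :=
  Matrix.of fun i j =>
    ⟪mfderiv 𝓘(ℝ, EuclideanSpace ℝ (Fin n)) (𝓡 n) (extChartAt (𝓡 n) x₀).symm y
        (EuclideanSpace.single i (1 : ℝ)),
      mfderiv 𝓘(ℝ, EuclideanSpace ℝ (Fin n)) (𝓡 n) (extChartAt (𝓡 n) x₀).symm y
        (EuclideanSpace.single j (1 : ℝ))⟫_ℝ

variable [MeasurableSpace M]

/-- The measure `√(det g_ij) dy` of the chart at `x₀`, transported to `M`. It is carried by the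
domain of that chart. -/
def chartVolume (x₀ : M) : Measure M :=
  ((volume.restrict (extChartAt (𝓡 n) x₀).target).withDensity
    fun y => ENNReal.ofReal (Real.sqrt (gramMatrix x₀ y).det)).map (extChartAt (𝓡 n) x₀).symm

variable (n M) in
/-- The Riemannian volume measure `dx`. The chart measures agree on overlaps of charts, and their
supremum is the measure on `M` that is given by `√(det g_ij) dy` in each chart. -/
def riemVolume : Measure M := ⨆ x₀ : M, chartVolume (n := n) x₀

/-! ### Functionals on densities -/

variable (n M) in
/-- The set `𝒫₊(M)` of smooth and strictly positive probability densities. -/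
def densities : Set (SmoothFn n M) :=
  {ρ | (∀ x, 0 < ρ x) ∧ ∫ x, ρ x ∂(riemVolume n M) = 1}

/-- `g` is the `L²` gradient at `u` of the functional `Φ` on `C^∞(M)`. -/
def HasL2Gradient (Φ : SmoothFn n M → ℝ) (u : SmoothFn n M) (g : M → ℝ) : Prop :=
  ∀ h : SmoothFn n M,
    HasDerivAt (fun ε : ℝ => Φ (u + ε • h)) (∫ x, g x * h x ∂(riemVolume n M)) 0

open Classical in
/-- The first variation `δF(u)`: the (unique) smooth `L²` gradient of `F` at `u`, when there is
one. -/
def firstVariation (F : SmoothFn n M → ℝ) (u : SmoothFn n M) : SmoothFn n M :=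
  if h : ∃ g : SmoothFn n M, HasL2Gradient F u g then h.choose else 0

end Riemannian

/-- A smooth finite-dimensional family of smooth functions on `M`. -/
def IsSmoothFamily {k : ℕ} (c : EuclideanSpace ℝ (Fin k) → SmoothFn n M) : Prop :=
  ContMDiff ((𝓡 k).prod (𝓡 n)) 𝓘(ℝ, ℝ) ∞ fun p : EuclideanSpace ℝ (Fin k) × M => c p.1 p.2

/-- `F` is a smooth functional with domain `D`, where `D` is an open set of smooth functions that
contains all positive ones, and `F` has a smooth first variation `δF : D → C^∞(M)`. Openness and
smoothness are those of calculus on the Fréchet space `C^∞(M)`, tested on smooth families. -/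
structure IsSmoothFunctional [RiemannianBundle (fun x : M => TangentSpace (𝓡 n) x)]
    [MeasurableSpace M] (D : Set (SmoothFn n M)) (F : SmoothFn n M → ℝ) : Prop where
  isOpen_domain : ∀ (k : ℕ) (c : EuclideanSpace ℝ (Fin k) → SmoothFn n M),
    IsSmoothFamily c → IsOpen {u | c u ∈ D}
  pos_mem : ∀ ρ : SmoothFn n M, (∀ x, 0 < ρ x) → ρ ∈ D
  smooth : ∀ (k : ℕ) (c : EuclideanSpace ℝ (Fin k) → SmoothFn n M),
    IsSmoothFamily c → ContDiffOn ℝ ∞ (fun u => F (c u)) {u | c u ∈ D}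
  exists_gradient : ∀ u ∈ D, ∃ g : SmoothFn n M, HasL2Gradient F u g
  smooth_firstVariation : ∀ (k : ℕ) (c : EuclideanSpace ℝ (Fin k) → SmoothFn n M),
    IsSmoothFamily c →
      ContMDiffOn ((𝓡 k).prod (𝓡 n)) 𝓘(ℝ, ℝ) ∞
        (fun p : EuclideanSpace ℝ (Fin k) × M => firstVariation F (c p.1) p.2)
        ({u | c u ∈ D} ×ˢ univ)

section Wasserstein

variable [RiemannianBundle (fun x : M => TangentSpace (𝓡 n) x)] [MeasurableSpace M]

/-- `V = V_Φ = -Δ_ρ Φ = -div(ρ ∇Φ)`, tested against smooth functions: the tangent vector at `ρ` of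
the density manifold that corresponds to the cotangent vector `Φ`. -/
def IsTangentOf (ρ Φ V : SmoothFn n M) : Prop :=
  ∀ ψ : SmoothFn n M, ∫ x, V x * ψ x ∂(riemVolume n M)
    = ∫ x, ρ x * gradInner n Φ ψ x ∂(riemVolume n M)

/-- The Wasserstein Hessian `Hess_W F(ρ)(V, V)` for `V = V_Φ`: the second variation
`∬ δ²F(ρ)(x,y) V(x) V(y) dx dy = ∬ ∇ₓ∇_y δ²F(ρ)(x,y) ∇Φ(x) ∇Φ(y) ρ(x) ρ(y) dx dy`
plus `∫ ∇²δF(ρ) (∇Φ, ∇Φ) ρ dx`. -/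
def wassersteinHess (F : SmoothFn n M → ℝ) (ρ Φ V : SmoothFn n M) : ℝ :=
  iteratedDeriv 2 (fun ε : ℝ => F (ρ + ε • V)) 0
    + ∫ x, hessGrad n (firstVariation F ρ) Φ x * ρ x ∂(riemVolume n M)

/-- `F` is `lam`-convex in the density manifold: `Hess_W F(ρ)(V, V) ≥ lam * g^W_ρ(V, V)` for all
tangent vectors `V`, where `g^W_ρ(V, V) = ∫ V (-Δ_ρ)^† V dx = ∫ V Φ dx` for `V = -Δ_ρ Φ`. -/
def IsWassersteinConvex (lam : ℝ) (F : SmoothFn n M → ℝ) : Prop :=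
  ∀ ρ ∈ densities n M, ∀ Φ V : SmoothFn n M, IsTangentOf ρ Φ V →
    lam * ∫ x, V x * Φ x ∂(riemVolume n M) ≤ wassersteinHess F ρ Φ V

/-- `F` is `a`-homogeneous with constant `b`: `F(ρ) = a⁻¹ ∫ δF(ρ) ρ dx + b` for all `ρ ∈ 𝒫₊(M)`. -/
def IsHomogeneousWith (a b : ℝ) (F : SmoothFn n M → ℝ) : Prop :=
  ∀ ρ ∈ densities n M, F ρ = a⁻¹ * ∫ x, firstVariation F ρ x * ρ x ∂(riemVolume n M) + b

/-- The Hamiltonian `H(ρ, S) = ½ ∫ |∇S|² ρ dx - ½ ∫ |∇δF(ρ)|² ρ dx`. -/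
def hamiltonian (F : SmoothFn n M → ℝ) (ρ S : SmoothFn n M) : ℝ :=
  1 / 2 * ∫ x, gradInner n S S x * ρ x ∂(riemVolume n M)
    - 1 / 2 * ∫ x, gradInner n (firstVariation F ρ) (firstVariation F ρ) x * ρ x ∂(riemVolume n M)

/-- `(ρ_t, S_t)`, `0 ≤ t ≤ 1`, is a smooth solution in `𝒫₊(M) × C^∞(M)` of the Hamiltonian flow
`∂_t ρ = ∂_S H(ρ, S)`, `∂_t S = -∂_ρ H(ρ, S)`. -/
structure IsHamiltonianFlow (F : SmoothFn n M → ℝ) (ρ S : ℝ → SmoothFn n M) : Prop where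
  smooth_density : ContMDiffOn (𝓘(ℝ, ℝ).prod (𝓡 n)) 𝓘(ℝ, ℝ) ∞
    (fun p : ℝ × M => ρ p.1 p.2) (Icc 0 1 ×ˢ univ)
  smooth_momentum : ContMDiffOn (𝓘(ℝ, ℝ).prod (𝓡 n)) 𝓘(ℝ, ℝ) ∞
    (fun p : ℝ × M => S p.1 p.2) (Icc 0 1 ×ˢ univ)
  mem_densities : ∀ t ∈ Icc (0 : ℝ) 1, ρ t ∈ densities n M
  density_eq : ∀ t ∈ Ioo (0 : ℝ) 1,
    HasL2Gradient (fun S' => hamiltonian F (ρ t) S') (S t) (fun x => deriv (fun s => ρ s x) t)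
  momentum_eq : ∀ t ∈ Ioo (0 : ℝ) 1,
    HasL2Gradient (fun ρ' => hamiltonian F ρ' (S t)) (ρ t) (fun x => -deriv (fun s => S s x) t)

/-- The generalized Hopf--Cole relation `s(η, η*) = (ρ, S)`. -/
def IsHopfCole (F : SmoothFn n M → ℝ) (η ηs ρ S : SmoothFn n M) : Prop :=
  firstVariation F ρ = firstVariation F η + firstVariation F ηs ∧
    S = firstVariation F η - firstVariation F ηs

/-- The density `(δF)⁻¹(δF(η) + δF(η*))`, where `δF` is inverted on `D`. -/
def hopfColeDensity (D : Set (SmoothFn n M)) (F : SmoothFn n M → ℝ) (η ηs : SmoothFn n M) :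
    SmoothFn n M :=
  Function.invFunOn (firstVariation F) D (firstVariation F η + firstVariation F ηs)

/-- The split energy `G(η, η*) = a⁻¹ ∫ (δF)⁻¹(δF(η) + δF(η*)) δF(η) dx + b / 2`. -/
def splitG (D : Set (SmoothFn n M)) (F : SmoothFn n M → ℝ) (a b : ℝ) (η ηs : SmoothFn n M) : ℝ :=
  a⁻¹ * ∫ x, hopfColeDensity D F η ηs x * firstVariation F η x ∂(riemVolume n M) + b / 2

/-- The split energy `G*(η, η*) = a⁻¹ ∫ (δF)⁻¹(δF(η) + δF(η*)) δF(η*) dx + b / 2`. -/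
def splitGstar (D : Set (SmoothFn n M)) (F : SmoothFn n M → ℝ) (a b : ℝ)
    (η ηs : SmoothFn n M) : ℝ :=
  a⁻¹ * ∫ x, hopfColeDensity D F η ηs x * firstVariation F ηs x ∂(riemVolume n M) + b / 2

end Wasserstein

/-- `α_t = (1 - e^{-2 lam t}) / (1 - e^{-2 lam})`, with the limit value `α_t = t` at `lam = 0`. -/
def alpha (lam t : ℝ) : ℝ :=
  if lam = 0 then t else (1 - Real.exp (-2 * lam * t)) / (1 - Real.exp (-2 * lam))

end HopfCole

end

/-! Write `u = δF(ρ)` and `φ = S + σ u` with `σ = ±1`; by the Hopf–Cole relation `φ` is `2 δF(η)`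
for `σ = 1` and `-2 δF(η*)` for `σ = -1`. Homogeneity turns the split energies into `½ F(ρ) + σ
(2a)⁻¹ ∫ ρ S` (`signedEnergy`), whose sum over the two signs is `F(ρ)`.

Two identities along the flow carry the proof. First (`split_deriv`), the signed energy plus `σ c t
H` has time derivative `P = σ/4 ∫ ρ |∇φ|²`. The degree `a` enters through homogeneity differentiated
in a direction of zero mean, and `c` is the constant that completes the square. Second
(`dissipation_deriv`), with `V = -div(ρ∇φ)` the flow gives `∂ₜφ = -½|∇φ|² + σ(∇u, ∇φ) + σ δ²F(ρ)V`,
hence `P' = ½ Hess_W F(ρ)(V, V)`, and `lam`-convexity yields `P' ≥ 2 lam σ P`. So `e^(-2 lam σ t) P`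
is nondecreasing: the corrected energy is a convex function of `τ(t) = ∫₀ᵗ e^(2 lam σ r) dr`. Its
chord inequality has weight `τ(t)/τ(1)`, which is `1 - α_{1-t}` for `σ = 1` and `α_t` for `σ = -1`.

`H` is constant by Hamilton's equations and the symmetry of `δ²F`. The functional is controlled only
through its gradient along lines and its smoothness on finite-dimensional families, so the chain
rule and this symmetry come from mixed partials on two-parameter families. The tangent vectors
`-div(ρ∇φ)` are built by integration by parts in charts. Since the flow is smooth only on the closed
interval, time is reparametrized by `t = sin² s`; all curves then live on the whole line and the
equations acquire the speed `θ = 2 sin s cos s`. -/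

noncomputable section

namespace HopfCole

/-! ### Coordinate frames, the Gram matrix and smoothness of `(∇f, ∇h)` -/

section
section Matrix

variable {EN : Type*} [NormedAddCommGroup EN] [NormedSpace ℝ EN] {HN : Type*} [TopologicalSpace HN]
  {J : ModelWithCorners ℝ EN HN} {N : Type*} [TopologicalSpace N] [ChartedSpace HN N]

theorem contMDiffAt_det {ι : Type*} [Fintype ι] [DecidableEq ι] {A : N → Matrix ι ι ℝ} {x : N}
    (h : ∀ i j, ContMDiffAt J 𝓘(ℝ, ℝ) ∞ (fun y => A y i j) x) :
    ContMDiffAt J 𝓘(ℝ, ℝ) ∞ (fun y => (A y).det) x := by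
  simp only [Matrix.det_apply, Units.smul_def, zsmul_eq_mul]
  refine contMDiffAt_finsetSum fun σ _ => contMDiffAt_const.mul ?_
  exact contMDiffAt_finsetProd fun i _ => h _ _

/-- Cramer's rule: the entries of the adjugate are determinants of the matrix with one row made
constant. -/
theorem contMDiffAt_inv {ι : Type*} [Fintype ι] [DecidableEq ι] {A : N → Matrix ι ι ℝ} {x : N}
    (h : ∀ i j, ContMDiffAt J 𝓘(ℝ, ℝ) ∞ (fun y => A y i j) x) (hx : (A x).det ≠ 0) (i j : ι) :
    ContMDiffAt J 𝓘(ℝ, ℝ) ∞ (fun y => (A y)⁻¹ i j) x := by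
  have h1 : ContMDiffAt J 𝓘(ℝ, ℝ) ∞ (fun y => ((A y).det)⁻¹ * (A y).adjugate i j) x := by
    refine ContMDiffAt.mul ((contMDiffAt_det h).inv₀ hx) ?_
    simp only [Matrix.adjugate_apply]
    refine contMDiffAt_det fun k l => ?_
    by_cases hk : k = j
    · subst hk
      simpa [Matrix.updateRow_self] using! contMDiffAt_const
    · simpa [Matrix.updateRow_ne hk] using! h k l
  simpa [Matrix.inv_def, Ring.inverse_eq_inv'] using! h1

end Matrix

/-- The inner product of the Riesz representatives, in terms of a basis. -/
theorem inner_toDual_symm_eq_sum {V : Type*} [NormedAddCommGroup V] [InnerProductSpace ℝ V]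
    [CompleteSpace V] {ι : Type*} [Fintype ι] [DecidableEq ι] (b : Module.Basis ι ℝ V)
    (K L : StrongDual ℝ V) :
    ⟪(InnerProductSpace.toDual ℝ V).symm K, (InnerProductSpace.toDual ℝ V).symm L⟫_ℝ
      = ∑ i, ∑ j, (Matrix.gram ℝ b)⁻¹ i j * K (b i) * L (b j) := by
  set k := (InnerProductSpace.toDual ℝ V).symm K
  have hdet : IsUnit (Matrix.gram ℝ b).det :=
    ((Matrix.posDef_gram_of_linearIndependent b.linearIndependent).det_pos.ne').isUnit
  have h1 : ∀ v, K v = ⟪k, v⟫_ℝ := fun v => by simp [k]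
  -- The Gram matrix maps the coordinates of the Riesz vector to the values of the functional on the
  -- basis; inverting it recovers the coordinates.
  have h2 : (fun i => K (b i)) = (Matrix.gram ℝ b).mulVec (b.repr k) := by
    ext i
    rw [h1]
    conv_lhs => rw [← b.sum_repr k, sum_inner]
    simp [Matrix.mulVec, dotProduct, Matrix.gram_apply, inner_smul_left, real_inner_comm, mul_comm]
  have h3 : (Matrix.gram ℝ b)⁻¹.mulVec (fun i => K (b i)) = b.repr k := by
    rw [h2, Matrix.mulVec_mulVec, Matrix.nonsing_inv_mul _ hdet, Matrix.one_mulVec]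
  have h4 : ((Matrix.gram ℝ b)⁻¹).transpose = (Matrix.gram ℝ b)⁻¹ := by
    rw [Matrix.transpose_nonsing_inv]
    congr 1
    ext i j
    simp [Matrix.gram_apply, real_inner_comm]
  rw [real_inner_comm, InnerProductSpace.toDual_symm_apply]
  conv_lhs => rw [← b.sum_repr k, map_sum]
  rw [Finset.sum_comm]
  refine Finset.sum_congr rfl fun j _ => ?_
  rw [map_smul, smul_eq_mul, ← Finset.sum_mul]
  congr 1
  rw [← congrFun h3 j]
  refine Finset.sum_congr rfl fun i _ => ?_
  exact congrArg (· * K (b i)) (congrFun (congrFun h4 j) i).symm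

variable {n : ℕ} {M : Type*} [TopologicalSpace M] [ChartedSpace (EuclideanSpace ℝ (Fin n)) M]
  [IsManifold (𝓡 n) ∞ M]

variable (n) in
/-- The coordinate frame of the chart at `x₀`. -/
def coordFrame (x₀ : M) (i : Fin n) (x : M) : TangentSpace (𝓡 n) x :=
  (trivializationAt (EuclideanSpace ℝ (Fin n)) (TangentSpace (𝓡 n) : M → Type _) x₀).localFrame
    (EuclideanSpace.basisFun (Fin n) ℝ).toBasis i x

theorem coordFrame_eq_symmL {x₀ x : M} (hx : x ∈ (chartAt (EuclideanSpace ℝ (Fin n)) x₀).source)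
    (i : Fin n) : coordFrame n x₀ i x =
      (trivializationAt (EuclideanSpace ℝ (Fin n)) (TangentSpace (𝓡 n) : M → Type _) x₀).symmL ℝ x
        (EuclideanSpace.single i 1) := by
  have hx' : x ∈ (trivializationAt (EuclideanSpace ℝ (Fin n))
    (TangentSpace (𝓡 n) : M → Type _) x₀).baseSet := by simpa using hx
  rw [coordFrame, Bundle.Trivialization.localFrame_apply_of_mem_baseSet _ _ hx']
  simp only [Bundle.Trivialization.basisAt, Module.Basis.map_apply,
    OrthonormalBasis.coe_toBasis, EuclideanSpace.basisFun_apply]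
  rw [Bundle.Trivialization.symmL_apply _ hx']
  rfl

/-- Links the bundle trivialization, whose frame is known to be smooth, with the chart derivative
used in `gramMatrix`. -/
theorem coordFrame_eq_mfderiv {x₀ x : M}
    (hx : x ∈ (chartAt (EuclideanSpace ℝ (Fin n)) x₀).source) (i : Fin n) :
    coordFrame n x₀ i x = mfderiv 𝓘(ℝ, EuclideanSpace ℝ (Fin n)) (𝓡 n) (extChartAt (𝓡 n) x₀).symm
      (extChartAt (𝓡 n) x₀ x) (EuclideanSpace.single i 1) := by
  rw [coordFrame_eq_symmL hx]
  have : IsManifold (𝓡 n) 1 M := IsManifold.of_le (n := ∞) (by simp)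
  rw [TangentBundle.symmL_trivializationAt hx]
  simp only [modelWithCornersSelf_coe, range_id, mfderivWithin_univ]
  rfl

/-- The differential of a family of functions along the coordinate frame is smooth. -/
theorem contMDiffAt_mvfderiv_coordFrame {EN : Type*} [NormedAddCommGroup EN] [NormedSpace ℝ EN]
    {HN : Type*} [TopologicalSpace HN]
    {J : ModelWithCorners ℝ EN HN} {N : Type*} [TopologicalSpace N] [ChartedSpace HN N]
    {f : N → M → ℝ} {g : N → M} {p : N}
    [IsManifold J ∞ N]
    (hf : ContMDiffAt (J.prod (𝓡 n)) 𝓘(ℝ, ℝ) ∞ (fun q : N × M => f q.1 q.2) (p, g p))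
    (hg : ContMDiffAt J (𝓡 n) ∞ g p) (i : Fin n) :
    ContMDiffAt J 𝓘(ℝ, ℝ) ∞
      (fun q => mvfderiv (𝓡 n) (f q) (g q) (coordFrame n (g p) i (g q))) p := by
  have : IsManifold (𝓡 n) 1 M := IsManifold.of_le (n := ∞) (by simp)
  have : IsManifold J 1 N := IsManifold.of_le (n := ∞) (by simp)
  have h := ContMDiffAt.mfderiv_apply (J := J) (J' := J) (I := 𝓡 n) (I' := 𝓘(ℝ, ℝ))
    (m := ∞) (n := ∞)
    (x₀ := p) f g id (fun _ => EuclideanSpace.single i (1 : ℝ)) hf hg contMDiffAt_id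
    contMDiffAt_const (by simp)
  refine h.congr_of_eventuallyEq ?_
  have hs : ∀ᶠ q in 𝓝 p, g q ∈ (chartAt (EuclideanSpace ℝ (Fin n)) (g p)).source :=
    hg.continuousAt.eventually ((chartAt _ _).open_source.mem_nhds (mem_chart_source _ _))
  filter_upwards [hs] with q hq
  rw [coordFrame_eq_symmL hq]
  simp only [inTangentCoordinates, ContinuousLinearMap.inCoordinates, mvfderiv, id,
    ContinuousLinearMap.comp_apply]
  erw [TangentBundle.continuousLinearMapAt_model_space]
  rfl

theorem coordFrame_linearIndependent_span {x₀ x : M}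
    (hx : x ∈ (chartAt (EuclideanSpace ℝ (Fin n)) x₀).source) :
    LinearIndependent ℝ (fun i => coordFrame n x₀ i x) ∧
      ⊤ ≤ Submodule.span ℝ (Set.range fun i => coordFrame n x₀ i x) := by
  have hx' : x ∈ (trivializationAt (EuclideanSpace ℝ (Fin n))
    (TangentSpace (𝓡 n) : M → Type _) x₀).baseSet := by simpa using hx
  have : IsManifold (𝓡 n) 1 M := IsManifold.of_le (n := ∞) (by simp)
  have h := (trivializationAt (EuclideanSpace ℝ (Fin n))
    (TangentSpace (𝓡 n) : M → Type _) x₀).isLocalFrameOn_localFrame_baseSet (𝓡 n) 0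
      (EuclideanSpace.basisFun (Fin n) ℝ).toBasis
  exact ⟨h.linearIndependent hx', h.generating hx'⟩

/-- The coordinate frame as a basis of the tangent space. -/
def coordBasis {x₀ x : M} (hx : x ∈ (chartAt (EuclideanSpace ℝ (Fin n)) x₀).source) :
    Module.Basis (Fin n) ℝ (TangentSpace (𝓡 n) x) :=
  Module.Basis.mk (coordFrame_linearIndependent_span hx).1 (coordFrame_linearIndependent_span hx).2

section Riemannian

variable [RiemannianBundle (fun x : M => TangentSpace (𝓡 n) x)]

variable (n) in
/-- The Gram matrix of the coordinate frame of the chart at `x₀`. -/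
def frameGram (x₀ x : M) : Matrix (Fin n) (Fin n) ℝ :=
  Matrix.gram ℝ (fun i => coordFrame n x₀ i x)

theorem frameGram_det_pos {x₀ x : M}
    (hx : x ∈ (chartAt (EuclideanSpace ℝ (Fin n)) x₀).source) : 0 < (frameGram n x₀ x).det :=
  (Matrix.posDef_gram_of_linearIndependent (coordFrame_linearIndependent_span hx).1).det_pos

/-- The classical `g^{ij} ∂_i f ∂_j h`. It removes the Riesz representatives, so that smoothness and
time derivatives can be read off factor by factor. -/
theorem gradInner_eq_sum (f h : M → ℝ) {x₀ x : M}
    (hx : x ∈ (chartAt (EuclideanSpace ℝ (Fin n)) x₀).source) :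
    gradInner n f h x = ∑ i, ∑ j, (frameGram n x₀ x)⁻¹ i j *
      mvfderiv (𝓡 n) f x (coordFrame n x₀ i x) * mvfderiv (𝓡 n) h x (coordFrame n x₀ j x) := by
  have : FiniteDimensional ℝ (TangentSpace (𝓡 n) x) :=
    inferInstanceAs (FiniteDimensional ℝ (EuclideanSpace ℝ (Fin n)))
  have : CompleteSpace (TangentSpace (𝓡 n) x) := FiniteDimensional.complete ℝ _
  have key := inner_toDual_symm_eq_sum (coordBasis hx) (mvfderiv (𝓡 n) f x) (mvfderiv (𝓡 n) h x)
  rw [coordBasis, Module.Basis.coe_mk] at key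
  exact key

variable [IsContMDiffRiemannianBundle (𝓡 n) ∞ (EuclideanSpace ℝ (Fin n))
      (fun x : M => TangentSpace (𝓡 n) x)]

theorem contMDiffAt_frameGram {x₀ x : M}
    (hx : x ∈ (chartAt (EuclideanSpace ℝ (Fin n)) x₀).source) (i j : Fin n) :
    ContMDiffAt (𝓡 n) 𝓘(ℝ, ℝ) ∞ (fun y => frameGram n x₀ y i j) x := by
  have hx' : x ∈ (trivializationAt (EuclideanSpace ℝ (Fin n))
    (TangentSpace (𝓡 n) : M → Type _) x₀).baseSet := by simpa using hx
  exact ContMDiffAt.inner_bundle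
    (contMDiffAt_localFrame_of_mem (n := ∞) (I := 𝓡 n) _
      (EuclideanSpace.basisFun (Fin n) ℝ).toBasis i hx')
    (contMDiffAt_localFrame_of_mem (n := ∞) (I := 𝓡 n) _
      (EuclideanSpace.basisFun (Fin n) ℝ).toBasis j hx')

/-- The parameter space `N` and the base-point map `g` let one statement serve both a fixed pair of
functions and a smooth curve of pairs. -/
theorem contMDiffAt_gradInner {EN : Type*} [NormedAddCommGroup EN] [NormedSpace ℝ EN]
    {HN : Type*} [TopologicalSpace HN]
    {J : ModelWithCorners ℝ EN HN} {N : Type*} [TopologicalSpace N] [ChartedSpace HN N]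
    [IsManifold J ∞ N] {f h : N → M → ℝ} {g : N → M} {p : N}
    (hf : ContMDiffAt (J.prod (𝓡 n)) 𝓘(ℝ, ℝ) ∞ (fun q : N × M => f q.1 q.2) (p, g p))
    (hh : ContMDiffAt (J.prod (𝓡 n)) 𝓘(ℝ, ℝ) ∞ (fun q : N × M => h q.1 q.2) (p, g p))
    (hg : ContMDiffAt J (𝓡 n) ∞ g p) :
    ContMDiffAt J 𝓘(ℝ, ℝ) ∞ (fun q => gradInner n (f q) (h q) (g q)) p := by
  have hs : ∀ᶠ q in 𝓝 p, g q ∈ (chartAt (EuclideanSpace ℝ (Fin n)) (g p)).source :=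
    hg.continuousAt.eventually ((chartAt _ _).open_source.mem_nhds (mem_chart_source _ _))
  have hp := mem_chart_source (EuclideanSpace ℝ (Fin n)) (g p)
  have key : ContMDiffAt J 𝓘(ℝ, ℝ) ∞ (fun q => ∑ i, ∑ j, (frameGram n (g p) (g q))⁻¹ i j *
      mvfderiv (𝓡 n) (f q) (g q) (coordFrame n (g p) i (g q)) *
        mvfderiv (𝓡 n) (h q) (g q) (coordFrame n (g p) j (g q))) p := by
    refine contMDiffAt_finsetSum fun i _ => contMDiffAt_finsetSum fun j _ => ?_
    refine (ContMDiffAt.mul ?_ (contMDiffAt_mvfderiv_coordFrame hf hg i)).mul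
      (contMDiffAt_mvfderiv_coordFrame hh hg j)
    exact (contMDiffAt_inv (contMDiffAt_frameGram hp) (frameGram_det_pos hp).ne' i j).comp p hg
  refine key.congr_of_eventuallyEq ?_
  filter_upwards [hs] with q hq
  exact gradInner_eq_sum _ _ hq

end Riemannian

end

/-! ### Smooth curves of functions, their time derivatives and their integrals -/

section
/-- Symmetry of mixed partial derivatives. -/
theorem hasDerivAt_fderiv_partial {E : Type*} [NormedAddCommGroup E] [NormedSpace ℝ E]
    {φ : ℝ × E → ℝ} {s : ℝ} {y : E} (hφ : ContDiffAt ℝ ∞ φ (s, y)) (v : E) :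
    HasDerivAt (fun r => fderiv ℝ (fun z => φ (r, z)) y v)
      (fderiv ℝ (fun z => deriv (fun r => φ (r, z)) s) y v) s := by
  have hev : ∀ᶠ q in 𝓝 (s, y), DifferentiableAt ℝ φ q := by
    have h1 : ContDiffAt ℝ 1 φ (s, y) := hφ.of_le (by exact_mod_cast le_top)
    exact (h1.eventually (by simp)).mono fun q hq => hq.differentiableAt (by simp)
  have h2 : DifferentiableAt ℝ (fderiv ℝ φ) (s, y) :=
    (hφ.fderiv_right (m := 1)
      (by rw [one_add_one_eq_two]; exact ENat.LEInfty.out)).differentiableAt (by simp)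
  -- Both iterated partials are values of the second Fréchet derivative on `(1, 0)` and `(0, v)`, in
  -- opposite orders.
  have hsymm := (hφ.isSymmSndFDerivAt (by simp; exact ENat.LEInfty.out)).eq (1, 0) (0, v)
  have e1 : (fun r => fderiv ℝ (fun z => φ (r, z)) y v) =ᶠ[𝓝 s]
      fun r => fderiv ℝ φ (r, y) (0, v) := by
    have : Filter.Tendsto (fun r : ℝ => (r, y)) (𝓝 s) (𝓝 (s, y)) := by
      exact (Continuous.prodMk_left y).continuousAt.tendsto
    filter_upwards [this.eventually hev] with r hr
    have := hr.hasFDerivAt.comp y (hasFDerivAt_prodMk_right r y)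
    rw [HasFDerivAt.fderiv (f := fun z => φ (r, z)) this]
    simp
  have e2 : (fun z => deriv (fun r => φ (r, z)) s) =ᶠ[𝓝 y]
      fun z => fderiv ℝ φ (s, z) (1, 0) := by
    have : Filter.Tendsto (fun z : E => (s, z)) (𝓝 y) (𝓝 (s, y)) := by
      exact (Continuous.prodMk_right s).continuousAt.tendsto
    filter_upwards [this.eventually hev] with z hz
    have := (hz.hasFDerivAt.comp s (hasFDerivAt_prodMk_left s z)).hasDerivAt
    rw [HasDerivAt.deriv (f := fun r => φ (r, z)) this]
    simp
  have d1 : HasDerivAt (fun r => fderiv ℝ φ (r, y) (0, v))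
      (fderiv ℝ (fderiv ℝ φ) (s, y) (1, 0) (0, v)) s := by
    have := (h2.hasFDerivAt.comp s (hasFDerivAt_prodMk_left s y)).hasDerivAt
    simpa using this.clm_apply (hasDerivAt_const s ((0 : ℝ), v))
  have d2 : HasFDerivAt (fun z => fderiv ℝ φ (s, z) (1, 0))
      (((fderiv ℝ (fderiv ℝ φ) (s, y)).comp (ContinuousLinearMap.inr ℝ ℝ E)).flip (1, 0)) y := by
    have := (h2.hasFDerivAt.comp y (hasFDerivAt_prodMk_right s y))
    simpa using! this.clm_apply (hasFDerivAt_const ((1 : ℝ), (0 : E)) y)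
  rw [e2.fderiv_eq, d2.fderiv]
  refine HasDerivAt.congr_of_eventuallyEq ?_ e1
  have e3 : (((fderiv ℝ (fderiv ℝ φ) (s, y)).comp (ContinuousLinearMap.inr ℝ ℝ E)).flip (1, 0)) v
      = fderiv ℝ (fderiv ℝ φ) (s, y) (1, 0) (0, v) := by
    simpa using hsymm.symm
  exact e3 ▸ d1

variable {n : ℕ} {M : Type*} [TopologicalSpace M] [ChartedSpace (EuclideanSpace ℝ (Fin n)) M]

namespace SmoothFn

variable (f g : SmoothFn n M) (c : ℝ) (x : M)

@[simp] theorem add_apply : (f + g) x = f x + g x := rfl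
@[simp] theorem sub_apply : (f - g) x = f x - g x := rfl
@[simp] theorem mul_apply : (f * g) x = f x * g x := rfl
@[simp] theorem smul_apply : (c • f) x = c * f x := rfl
@[simp] theorem one_apply : (1 : SmoothFn n M) x = 1 := rfl

end SmoothFn

/-- A curve of smooth functions that is jointly smooth. -/
def IsSmoothPath (f : ℝ → SmoothFn n M) : Prop :=
  ContMDiff (𝓘(ℝ, ℝ).prod (𝓡 n)) 𝓘(ℝ, ℝ) ∞ fun p : ℝ × M => f p.1 p.2

/-- `f'` is the pointwise derivative of the curve `f`. -/
def IsPathDeriv (f f' : ℝ → SmoothFn n M) : Prop :=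
  ∀ s x, HasDerivAt (fun r => f r x) (f' s x) s

namespace IsPathDeriv

variable {f f' h h' : ℝ → SmoothFn n M}

theorem add (hf : IsPathDeriv f f') (hh : IsPathDeriv h h') :
    IsPathDeriv (fun s => f s + h s) (fun s => f' s + h' s) :=
  fun s x => (hf s x).add (hh s x)

theorem sub (hf : IsPathDeriv f f') (hh : IsPathDeriv h h') :
    IsPathDeriv (fun s => f s - h s) (fun s => f' s - h' s) :=
  fun s x => (hf s x).sub (hh s x)

theorem smul (c : ℝ) (hf : IsPathDeriv f f') : IsPathDeriv (fun s => c • f s) (fun s => c • f' s) :=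
  fun s x => by simpa using (hf s x).const_mul c

theorem mul (hf : IsPathDeriv f f') (hh : IsPathDeriv h h') :
    IsPathDeriv (fun s => f s * h s) (fun s => f' s * h s + f s * h' s) :=
  fun s x => (hf s x).mul (hh s x)

theorem const (g : SmoothFn n M) : IsPathDeriv (fun _ => g) (fun _ => 0) :=
  fun s x => hasDerivAt_const s (g x)

end IsPathDeriv

namespace IsSmoothPath

variable {f h : ℝ → SmoothFn n M}

theorem add (hf : IsSmoothPath f) (hh : IsSmoothPath h) : IsSmoothPath (fun s => f s + h s) :=
  ContMDiff.add hf hh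

theorem sub (hf : IsSmoothPath f) (hh : IsSmoothPath h) : IsSmoothPath (fun s => f s - h s) :=
  ContMDiff.sub hf hh

theorem mul (hf : IsSmoothPath f) (hh : IsSmoothPath h) : IsSmoothPath (fun s => f s * h s) :=
  ContMDiff.mul hf hh

theorem const (g : SmoothFn n M) : IsSmoothPath (fun _ => g) :=
  g.contMDiff.comp contMDiff_snd

theorem smul (hf : IsSmoothPath f) {c : ℝ → ℝ} (hc : ContDiff ℝ ∞ c) :
    IsSmoothPath (fun s => c s • f s) :=
  ContMDiff.mul (hc.contMDiff.comp contMDiff_fst) hf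

theorem continuous (hf : IsSmoothPath f) : Continuous fun p : ℝ × M => f p.1 p.2 :=
  ContMDiff.continuous hf

end IsSmoothPath

theorem IsSmoothPath.exists_pathDeriv [IsManifold (𝓡 n) ∞ M] {f : ℝ → SmoothFn n M}
    (hf : IsSmoothPath f) :
    ∃ f', IsSmoothPath f' ∧ IsPathDeriv f f' := by
  have : IsManifold (𝓡 n) 1 M := IsManifold.of_le (n := ∞) (by simp)
  have hd : ∀ s x, HasDerivAt (fun r => f r x) (deriv (fun r => f r x) s) s := fun s x => by
    have h1 : ContMDiff 𝓘(ℝ, ℝ) 𝓘(ℝ, ℝ) ∞ (fun r : ℝ => f r x) :=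
      ContMDiff.comp hf (contMDiff_id.prodMk contMDiff_const)
    exact (h1.contDiff.differentiable (by simp) s).hasDerivAt
  have hsm : ContMDiff (𝓘(ℝ, ℝ).prod (𝓡 n)) 𝓘(ℝ, ℝ) ∞
      fun p : ℝ × M => deriv (fun r => f r p.2) p.1 := by
    intro p
    have h := ContMDiffAt.mfderiv_apply (J := 𝓘(ℝ, ℝ).prod (𝓡 n)) (J' := 𝓘(ℝ, ℝ).prod (𝓡 n))
      (I := 𝓘(ℝ, ℝ)) (I' := 𝓘(ℝ, ℝ)) (m := ∞) (n := ∞) (x₀ := p)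
      (fun (q : ℝ × M) (r : ℝ) => f r q.2) (fun q : ℝ × M => q.1) id (fun _ => (1 : ℝ))
      (ContMDiff.contMDiffAt
        (ContMDiff.comp hf (contMDiff_snd.prodMk (contMDiff_snd.comp contMDiff_fst))))
      contMDiff_fst.contMDiffAt contMDiffAt_id
      contMDiffAt_const (by simp)
    refine h.congr_of_eventuallyEq (Filter.Eventually.of_forall fun q => ?_)
    erw [inTangentCoordinates_model_space]
    simp only [id]
    erw [mfderiv_eq_fderiv]
    rfl
  exact ⟨fun s => ⟨fun x => deriv (fun r => f r x) s,
    hsm.comp (contMDiff_const.prodMk contMDiff_id)⟩, hsm, hd⟩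

theorem mvfderiv_eq_fderiv_chart {f : M → ℝ} {x : M} (hf : MDifferentiableAt (𝓡 n) 𝓘(ℝ, ℝ) f x)
    (v : EuclideanSpace ℝ (Fin n)) : mvfderiv (𝓡 n) f x v =
      fderiv ℝ (fun y => f ((extChartAt (𝓡 n) x).symm y)) (extChartAt (𝓡 n) x x) v := by
  simp [mvfderiv, mfderiv, hf, writtenInExtChartAt]
  rfl

/-- Time and space derivatives commute: in the chart centred at `x` this is the symmetry of mixed
partials. -/
theorem hasDerivAt_mvfderiv [IsManifold (𝓡 n) ∞ M] {f f' : ℝ → SmoothFn n M} (hf : IsSmoothPath f)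
    (hf' : IsPathDeriv f f') (s : ℝ) (x : M) (v : TangentSpace (𝓡 n) x) :
    HasDerivAt (fun r => mvfderiv (𝓡 n) (f r) x v) (mvfderiv (𝓡 n) (f' s) x v) s := by
  have h1 : ∀ g : SmoothFn n M, mvfderiv (𝓡 n) g x v = _ := fun g =>
    mvfderiv_eq_fderiv_chart (g.contMDiff.mdifferentiable (by simp) x) v
  simp only [h1]
  have h2 : ContDiffAt ℝ ∞
      (fun p : ℝ × EuclideanSpace ℝ (Fin n) => f p.1 ((extChartAt (𝓡 n) x).symm p.2))
      (s, extChartAt (𝓡 n) x x) := by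
    rw [← contMDiffAt_iff_contDiffAt]
    have h3 : ContMDiffAt 𝓘(ℝ, EuclideanSpace ℝ (Fin n)) (𝓡 n) ∞ (extChartAt (𝓡 n) x).symm
        (extChartAt (𝓡 n) x x) := by
      exact (contMDiffOn_extChartAt_symm x).contMDiffAt (extChartAt_target_mem_nhds x)
    have h4 : ContMDiffAt 𝓘(ℝ, ℝ × EuclideanSpace ℝ (Fin n)) (𝓘(ℝ, ℝ).prod (𝓡 n)) ∞
      (fun p : ℝ × EuclideanSpace ℝ (Fin n) => (p.1, (extChartAt (𝓡 n) x).symm p.2))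
      (s, extChartAt (𝓡 n) x x) :=
      contDiff_fst.contMDiff.contMDiffAt.prodMk
        (h3.comp (s, extChartAt (𝓡 n) x x) contDiff_snd.contMDiff.contMDiffAt)
    exact (ContMDiff.contMDiffAt hf).comp _ h4
  have h5 := hasDerivAt_fderiv_partial h2 v
  simpa only [(hf' s _).deriv] using h5

section Riemannian

variable [IsManifold (𝓡 n) ∞ M] [RiemannianBundle (fun x : M => TangentSpace (𝓡 n) x)]
  [IsContMDiffRiemannianBundle (𝓡 n) ∞ (EuclideanSpace ℝ (Fin n))
      (fun x : M => TangentSpace (𝓡 n) x)]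

/-- The smooth function `(∇f, ∇h)`. -/
def gradPair (f h : SmoothFn n M) : SmoothFn n M :=
  ⟨gradInner n f h, fun _ => contMDiffAt_gradInner (N := M) (J := 𝓡 n) (f := fun _ => f)
    (h := fun _ => h) (g := id) (f.contMDiff.comp contMDiff_snd).contMDiffAt
    (h.contMDiff.comp contMDiff_snd).contMDiffAt contMDiffAt_id⟩

@[simp]
theorem gradPair_apply (f h : SmoothFn n M) (x : M) : gradPair f h x = gradInner n f h x := rfl

theorem gradPair_apply_eq_sum (f h : SmoothFn n M) (x : M) :
    gradPair f h x = ∑ i, ∑ j, (frameGram n x x)⁻¹ i j *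
      mvfderiv (𝓡 n) f x (coordFrame n x i x) * mvfderiv (𝓡 n) h x (coordFrame n x j x) :=
  gradInner_eq_sum _ _ (mem_chart_source _ _)

theorem gradPair_comm (f h : SmoothFn n M) : gradPair f h = gradPair h f := by
  ext x
  simp only [gradPair_apply, gradInner]
  exact real_inner_comm (grad h x : TangentSpace (𝓡 n) x) (grad f x)

theorem gradPair_add_left (f g h : SmoothFn n M) :
    gradPair (f + g) h = gradPair f h + gradPair g h := by
  ext x
  have : mvfderiv (𝓡 n) (⇑(f + g)) x = mvfderiv (𝓡 n) f x + mvfderiv (𝓡 n) g x :=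
    mvfderiv_add (f.contMDiff.mdifferentiable (by simp) x) (g.contMDiff.mdifferentiable (by simp) x)
  simp only [gradPair_apply_eq_sum, this, SmoothFn.add_apply, add_apply,
    ← Finset.sum_add_distrib]
  exact Finset.sum_congr rfl fun i _ => Finset.sum_congr rfl fun j _ => by ring

theorem gradPair_smul_left (c : ℝ) (f h : SmoothFn n M) :
    gradPair (c • f) h = c • gradPair f h := by
  ext x
  have : ∀ v, mvfderiv (𝓡 n) (⇑(c • f)) x v = c * mvfderiv (𝓡 n) f x v := fun v => by
    have h1 : HasMFDerivAt (𝓡 n) 𝓘(ℝ, ℝ) (⇑(c • f)) x (c • mfderiv (𝓡 n) 𝓘(ℝ, ℝ) f x) :=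
      (f.contMDiff.mdifferentiable (by simp) x).hasMFDerivAt.const_smul c
    simp only [mvfderiv, h1.mfderiv]
    rfl
  simp only [gradPair_apply_eq_sum, this, SmoothFn.smul_apply,
    Finset.mul_sum]
  exact Finset.sum_congr rfl fun i _ => Finset.sum_congr rfl fun j _ => by ring

theorem gradPair_one_right (f : SmoothFn n M) : gradPair f 1 = 0 := by
  ext x
  have : mvfderiv (𝓡 n) (⇑(1 : SmoothFn n M)) x = 0 := mvfderiv_const (1 : ℝ)
  rw [gradPair_apply_eq_sum, this]
  simp

theorem IsSmoothPath.gradPair {f h : ℝ → SmoothFn n M} (hf : IsSmoothPath f)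
    (hh : IsSmoothPath h) : IsSmoothPath fun s => gradPair (f s) (h s) := by
  intro p
  have hq : ∀ {k : ℝ → SmoothFn n M}, IsSmoothPath k →
      ContMDiffAt ((𝓘(ℝ, ℝ).prod (𝓡 n)).prod (𝓡 n)) 𝓘(ℝ, ℝ) ∞
        (fun q : (ℝ × M) × M => k q.1.1 q.2) (p, p.2) := fun hk =>
    (ContMDiff.comp hk ((contMDiff_fst.comp contMDiff_fst).prodMk contMDiff_snd)).contMDiffAt
  exact contMDiffAt_gradInner (N := ℝ × M) (J := 𝓘(ℝ, ℝ).prod (𝓡 n)) (f := fun q => f q.1)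
    (h := fun q => h q.1) (g := Prod.snd) (hq hf) (hq hh) contMDiffAt_snd

/-- In the frame at the fixed point `x` the metric coefficients do not depend on time, so the
product rule for the two differentials suffices. -/
theorem IsPathDeriv.gradPair {f f' h h' : ℝ → SmoothFn n M} (hf : IsSmoothPath f)
    (hf' : IsPathDeriv f f') (hh : IsSmoothPath h) (hh' : IsPathDeriv h h') :
    IsPathDeriv (fun s => gradPair (f s) (h s))
      (fun s => HopfCole.gradPair (f' s) (h s) + HopfCole.gradPair (f s) (h' s)) := by
  intro s x
  simp only [gradPair_apply_eq_sum, SmoothFn.add_apply, ← Finset.sum_add_distrib]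
  refine HasDerivAt.fun_sum fun i _ => HasDerivAt.fun_sum fun j _ => ?_
  exact ((hasDerivAt_mvfderiv hf hf' s x _).const_mul _).mul (hasDerivAt_mvfderiv hh hh' s x _)

end Riemannian

section Integral

variable [CompactSpace M] [MeasurableSpace M] [BorelSpace M]

theorem SmoothFn.integrable (μ : Measure M) [IsFiniteMeasure μ] (f : SmoothFn n M) :
    Integrable (fun x => f x) μ :=
  f.contMDiff.continuous.integrable_of_hasCompactSupport (HasCompactSupport.of_compactSpace _)

/-- Compactness of `M` bounds `f'` uniformly near `s`, and a constant is an integrable bound for a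
finite measure. -/
theorem IsPathDeriv.hasDerivAt_integral (μ : Measure M) [IsFiniteMeasure μ]
    {f f' : ℝ → SmoothFn n M} (hf'c : IsSmoothPath f')
    (hf' : IsPathDeriv f f') (s : ℝ) :
    HasDerivAt (fun r => ∫ x, f r x ∂μ) (∫ x, f' s x ∂μ) s := by
  have hK : IsCompact (Metric.closedBall s 1 ×ˢ (univ : Set M)) :=
    (isCompact_closedBall s 1).prod isCompact_univ
  obtain ⟨C, hC⟩ := hK.exists_bound_of_continuousOn hf'c.continuous.continuousOn
  refine (hasDerivAt_integral_of_dominated_loc_of_deriv_le (F := fun r x => f r x)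
    (F' := fun r x => f' r x) (bound := fun _ => C) (Metric.ball_mem_nhds s one_pos)
    (Filter.Eventually.of_forall fun r => ((f r).integrable μ).aestronglyMeasurable)
    ((f s).integrable μ) ((f' s).integrable μ).aestronglyMeasurable
    (Filter.Eventually.of_forall fun x r hr => ?_) (integrable_const C)
    (Filter.Eventually.of_forall fun x r _ => hf' r x)).2
  exact hC (r, x) ⟨Metric.ball_subset_closedBall hr, mem_univ x⟩

end Integral

end

/-! ### The Riemannian volume in charts -/

section
variable {n : ℕ} {M : Type*} [TopologicalSpace M] [ChartedSpace (EuclideanSpace ℝ (Fin n)) M]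

theorem mdifferentiableAt_extChartAt_symm [IsManifold (𝓡 n) ∞ M] {x₀ : M}
    {y : EuclideanSpace ℝ (Fin n)} (hy : y ∈ (extChartAt (𝓡 n) x₀).target) :
    MDifferentiableAt 𝓘(ℝ, EuclideanSpace ℝ (Fin n)) (𝓡 n) (extChartAt (𝓡 n) x₀).symm y :=
  ((contMDiffOn_extChartAt_symm (n := ∞) x₀).contMDiffAt
    ((isOpen_extChartAt_target x₀).mem_nhds hy)).mdifferentiableAt (by simp)

theorem coordFrame_symm_eq_mfderiv [IsManifold (𝓡 n) ∞ M] {x₀ : M} {y : EuclideanSpace ℝ (Fin n)}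
    (hy : y ∈ (extChartAt (𝓡 n) x₀).target) (i : Fin n) :
    coordFrame n x₀ i ((extChartAt (𝓡 n) x₀).symm y) =
      mfderiv 𝓘(ℝ, EuclideanSpace ℝ (Fin n)) (𝓡 n) (extChartAt (𝓡 n) x₀).symm y
        (EuclideanSpace.single i 1) := by
  have hx : (extChartAt (𝓡 n) x₀).symm y ∈ (chartAt (EuclideanSpace ℝ (Fin n)) x₀).source := by
    simpa using (extChartAt (𝓡 n) x₀).map_target hy
  have h := coordFrame_eq_mfderiv hx i
  rw [h]
  -- The two derivatives take values in tangent spaces over propositionally equal points; the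
  -- comparison is made in the model space, where both have the same type.
  have key : ∀ z, z = y →
      (mfderiv 𝓘(ℝ, EuclideanSpace ℝ (Fin n)) (𝓡 n) (extChartAt (𝓡 n) x₀).symm z
        (EuclideanSpace.single i 1) : EuclideanSpace ℝ (Fin n)) =
      mfderiv 𝓘(ℝ, EuclideanSpace ℝ (Fin n)) (𝓡 n) (extChartAt (𝓡 n) x₀).symm y
        (EuclideanSpace.single i 1) := by
    rintro z rfl
    rfl
  exact key _ ((extChartAt (𝓡 n) x₀).right_inv hy)

section Riemannian

variable [RiemannianBundle (fun x : M => TangentSpace (𝓡 n) x)]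

theorem gramMatrix_eq_frameGram [IsManifold (𝓡 n) ∞ M] {x₀ : M} {y : EuclideanSpace ℝ (Fin n)}
    (hy : y ∈ (extChartAt (𝓡 n) x₀).target) :
    gramMatrix x₀ y = frameGram n x₀ ((extChartAt (𝓡 n) x₀).symm y) := by
  ext i j
  simp only [gramMatrix, frameGram, Matrix.of_apply, Matrix.gram_apply]
  rw [coordFrame_symm_eq_mfderiv hy, coordFrame_symm_eq_mfderiv hy]

/-- The density `√(det g_ij)` of the volume in the chart at `x₀`. -/
def volDensity (x₀ : M) (y : EuclideanSpace ℝ (Fin n)) : ℝ := Real.sqrt (gramMatrix x₀ y).det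

theorem volDensity_pos [IsManifold (𝓡 n) ∞ M] {x₀ : M} {y : EuclideanSpace ℝ (Fin n)}
    (hy : y ∈ (extChartAt (𝓡 n) x₀).target) : 0 < volDensity x₀ y := by
  rw [volDensity, gramMatrix_eq_frameGram hy]
  exact Real.sqrt_pos.2 (frameGram_det_pos (by simpa using (extChartAt (𝓡 n) x₀).map_target hy))

theorem contDiffOn_volDensity [IsManifold (𝓡 n) ∞ M]
    [IsContMDiffRiemannianBundle (𝓡 n) ∞ (EuclideanSpace ℝ (Fin n))
      (fun x : M => TangentSpace (𝓡 n) x)] (x₀ : M) :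
    ContDiffOn ℝ ∞ (volDensity (n := n) x₀) (extChartAt (𝓡 n) x₀).target := by
  intro y hy
  have hy' := (isOpen_extChartAt_target (I := 𝓡 n) x₀).mem_nhds hy
  have hx : (extChartAt (𝓡 n) x₀).symm y ∈ (chartAt (EuclideanSpace ℝ (Fin n)) x₀).source := by
    simpa using (extChartAt (𝓡 n) x₀).map_target hy
  have h1 : ContDiffAt ℝ ∞ (fun z => (frameGram n x₀ ((extChartAt (𝓡 n) x₀).symm z)).det) y := by
    rw [← contMDiffAt_iff_contDiffAt]
    exact (contMDiffAt_det (contMDiffAt_frameGram hx)).comp y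
      ((contMDiffOn_extChartAt_symm x₀).contMDiffAt hy')
  refine ((h1.sqrt (frameGram_det_pos hx).ne').congr_of_eventuallyEq ?_).contDiffWithinAt
  filter_upwards [hy'] with z hz
  rw [volDensity, gramMatrix_eq_frameGram hz]

variable [MeasurableSpace M] [BorelSpace M]

theorem aemeasurable_extChartAt_symm (x₀ : M) :
    AEMeasurable (extChartAt (𝓡 n) x₀).symm
      ((volume.restrict (extChartAt (𝓡 n) x₀).target).withDensity
      fun y => ENNReal.ofReal (volDensity x₀ y)) :=
  ((continuousOn_extChartAt_symm x₀).aemeasurable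
    (isOpen_extChartAt_target x₀).measurableSet).mono_ac (withDensity_absolutelyContinuous _ _)

omit [BorelSpace M] in
theorem chartVolume_eq (x₀ : M) : chartVolume (n := n) x₀ =
    ((volume.restrict (extChartAt (𝓡 n) x₀).target).withDensity
      fun y => ENNReal.ofReal (volDensity x₀ y)).map (extChartAt (𝓡 n) x₀).symm := rfl

theorem chartVolume_apply (x₀ : M) {A : Set M} (hA : MeasurableSet A) :
    chartVolume (n := n) x₀ A =
      ∫⁻ y in (extChartAt (𝓡 n) x₀).symm ⁻¹' A ∩ (extChartAt (𝓡 n) x₀).target,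
        ENNReal.ofReal (volDensity x₀ y) := by
  rw [chartVolume_eq, Measure.map_apply_of_aemeasurable (aemeasurable_extChartAt_symm x₀) hA,
    withDensity_apply', Measure.restrict_restrict' (isOpen_extChartAt_target x₀).measurableSet]

omit [RiemannianBundle (fun x : M => TangentSpace (𝓡 n) x)] in
-- The inverse chart is known to be continuous only on its target, hence the passage through the
-- subtype.
theorem measurableSet_extChartAt_symm_preimage (x₀ : M) {A : Set M} (hA : MeasurableSet A) :
    MeasurableSet ((extChartAt (𝓡 n) x₀).symm ⁻¹' A ∩ (extChartAt (𝓡 n) x₀).target) := by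
  have h1 : Measurable ((extChartAt (𝓡 n) x₀).target.domRestrict (extChartAt (𝓡 n) x₀).symm) :=
    (continuousOn_iff_continuous_domRestrict.1 (continuousOn_extChartAt_symm x₀)).measurable
  have h2 := (isOpen_extChartAt_target (I := 𝓡 n) x₀).measurableSet.subtype_image (h1 hA)
  convert h2 using 1
  ext y
  simp only [mem_inter_iff, mem_preimage, mem_image, Subtype.exists, domRestrict_apply]
  constructor
  · rintro ⟨h, h'⟩
    exact ⟨y, h', h, rfl⟩
  · rintro ⟨z, hz, hz', rfl⟩
    exact ⟨hz', hz⟩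

omit [MeasurableSpace M] [BorelSpace M] in
-- With `P` the Jacobian matrix of the transition map, the Gram matrices are related by `Pᵀ g P`;
-- the square root of the determinant produces `|det P|`.
theorem volDensity_coord_change [IsManifold (𝓡 n) ∞ M] {x₀ x₁ : M}
    {y : EuclideanSpace ℝ (Fin n)} (hy : y ∈ (extChartAt (𝓡 n) x₀).target)
    (hy' : (extChartAt (𝓡 n) x₀).symm y ∈ (extChartAt (𝓡 n) x₁).source) :
    ∃ L : EuclideanSpace ℝ (Fin n) →L[ℝ] EuclideanSpace ℝ (Fin n),
      HasFDerivAt (fun z => extChartAt (𝓡 n) x₁ ((extChartAt (𝓡 n) x₀).symm z)) L y ∧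
      volDensity x₀ y =
        |L.det| * volDensity x₁ (extChartAt (𝓡 n) x₁ ((extChartAt (𝓡 n) x₀).symm y)) := by
  have : IsManifold (𝓡 n) 1 M := IsManifold.of_le (n := ∞) (by simp)
  set φ₀ := extChartAt (𝓡 n) x₀ with hφ₀
  set φ₁ := extChartAt (𝓡 n) x₁ with hφ₁
  set T : EuclideanSpace ℝ (Fin n) → EuclideanSpace ℝ (Fin n) := fun z => φ₁ (φ₀.symm z) with hT
  have hTy : T y ∈ φ₁.target := φ₁.map_source hy'
  have hxx : φ₁.symm (T y) = φ₀.symm y := φ₁.left_inv hy'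
  have d0 := (mdifferentiableAt_extChartAt_symm hy)
  have d1 := (mdifferentiableAt_extChartAt_symm hTy)
  have dT : DifferentiableAt ℝ T y := by
    rw [← mdifferentiableAt_iff_differentiableAt]
    exact (mdifferentiableAt_extChartAt (by simpa [hφ₁] using hy')).comp y d0
  have hev : φ₀.symm =ᶠ[𝓝 y] fun z => φ₁.symm (T z) := by
    have h1 : ContinuousAt φ₀.symm y := d0.continuousAt
    filter_upwards [h1.preimage_mem_nhds ((isOpen_extChartAt_source x₁).mem_nhds hy')] with z hz
    exact (φ₁.left_inv hz).symm
  let Q : EuclideanSpace ℝ (Fin n) →L[ℝ] EuclideanSpace ℝ (Fin n) :=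
    mfderiv 𝓘(ℝ, EuclideanSpace ℝ (Fin n)) (𝓡 n) φ₁.symm (T y)
  have hcomp : ∀ v : EuclideanSpace ℝ (Fin n),
      (mfderiv 𝓘(ℝ, EuclideanSpace ℝ (Fin n)) (𝓡 n) φ₀.symm y v : EuclideanSpace ℝ (Fin n)) =
      Q (fderiv ℝ T y v) := by
    intro v
    have h2 := (d1.hasMFDerivAt.comp y dT.hasFDerivAt.hasMFDerivAt).congr_of_eventuallyEq hev
    rw [h2.mfderiv]
    rfl
  refine ⟨fderiv ℝ T y, dT.hasFDerivAt, ?_⟩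
  set P := LinearMap.toMatrix (EuclideanSpace.basisFun (Fin n) ℝ).toBasis
    (EuclideanSpace.basisFun (Fin n) ℝ).toBasis (fderiv ℝ T y : _ →ₗ[ℝ] _) with hP
  have hdetP : P.det = (fderiv ℝ T y).det := LinearMap.det_toMatrix _ _
  have hframe : ∀ i, coordFrame n x₀ i (φ₀.symm y) =
      ∑ k, P k i • coordFrame n x₁ k (φ₀.symm y) := by
    intro i
    have h3 : (fderiv ℝ T y (EuclideanSpace.single i 1)) =
        ∑ k, P k i • EuclideanSpace.single k (1 : ℝ) := by
      have := (EuclideanSpace.basisFun (Fin n) ℝ).toBasis.sum_repr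
        (fderiv ℝ T y (EuclideanSpace.single i 1))
      rw [← this]
      simp [hP, LinearMap.toMatrix_apply]
    have h4 : ∀ k, (coordFrame n x₁ k (φ₀.symm y) : EuclideanSpace ℝ (Fin n)) =
        Q (EuclideanSpace.single k 1) := by
      intro k
      exact (congrArg (fun z => (coordFrame n x₁ k z : EuclideanSpace ℝ (Fin n))) hxx.symm).trans
        (coordFrame_symm_eq_mfderiv hTy k)
    have h5 : _ = Q _ := hcomp (EuclideanSpace.single i 1)
    have h6 : Q (fderiv ℝ T y (EuclideanSpace.single i 1)) =
        ∑ k, P k i • Q (EuclideanSpace.single k 1) := by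
      simp only [h3, map_sum, map_smul]
    rw [coordFrame_symm_eq_mfderiv hy]
    refine h5.trans (h6.trans (Finset.sum_congr rfl fun k _ => ?_))
    rw [← h4 k]
    rfl
  have hgram : gramMatrix x₀ y = P.transpose * gramMatrix x₁ (T y) * P := by
    rw [gramMatrix_eq_frameGram hy, gramMatrix_eq_frameGram hTy, ← hφ₁, ← hφ₀, hxx]
    ext i j
    simp only [frameGram, Matrix.gram_apply, Matrix.mul_apply, hframe, sum_inner, inner_sum,
      inner_smul_left, inner_smul_right, Matrix.transpose_apply, Finset.sum_mul, Finset.mul_sum]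
    refine Finset.sum_congr rfl fun k _ => Finset.sum_congr rfl fun l _ => ?_
    simp only [conj_trivial]
    ring
  rw [volDensity, hgram, Matrix.det_mul, Matrix.det_mul, Matrix.det_transpose, mul_right_comm,
    Real.sqrt_mul (mul_self_nonneg _), Real.sqrt_mul_self_eq_abs, hdetP]
  rfl

/-- The change of variables formula for the transition map, whose Jacobian is exactly the ratio of
the two densities. -/
theorem chartVolume_eq_of_subset [IsManifold (𝓡 n) ∞ M] {x₀ x₁ : M} {A : Set M}
    (hA : MeasurableSet A) (h0 : A ⊆ (extChartAt (𝓡 n) x₀).source)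
    (h1 : A ⊆ (extChartAt (𝓡 n) x₁).source) :
    chartVolume (n := n) x₁ A = chartVolume (n := n) x₀ A := by
  rw [chartVolume_apply _ hA, chartVolume_apply _ hA]
  set s := (extChartAt (𝓡 n) x₀).symm ⁻¹' A ∩ (extChartAt (𝓡 n) x₀).target with hs
  set T : EuclideanSpace ℝ (Fin n) → EuclideanSpace ℝ (Fin n) :=
    fun z => extChartAt (𝓡 n) x₁ ((extChartAt (𝓡 n) x₀).symm z) with hT
  have himg : (extChartAt (𝓡 n) x₁).symm ⁻¹' A ∩ (extChartAt (𝓡 n) x₁).target = T '' s := by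
    ext z
    constructor
    · rintro ⟨hz, hz'⟩
      refine ⟨extChartAt (𝓡 n) x₀ ((extChartAt (𝓡 n) x₁).symm z), ⟨?_, ?_⟩, ?_⟩
      · rw [mem_preimage, (extChartAt (𝓡 n) x₀).left_inv (h0 hz)]
        exact hz
      · exact (extChartAt (𝓡 n) x₀).map_source (h0 hz)
      · simp only [hT]
        rw [(extChartAt (𝓡 n) x₀).left_inv (h0 hz), (extChartAt (𝓡 n) x₁).right_inv hz']
    · rintro ⟨y, ⟨hy, hy'⟩, rfl⟩
      refine ⟨?_, (extChartAt (𝓡 n) x₁).map_source (h1 hy)⟩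
      simpa only [mem_preimage, hT, (extChartAt (𝓡 n) x₁).left_inv (h1 hy)] using! hy
  have hex := fun y : s => volDensity_coord_change (x₁ := x₁) y.2.2 (h1 y.2.1)
  choose! L hL using hex
  classical
  have hinj : InjOn T s := by
    intro y hy z hz hyz
    have := congrArg (extChartAt (𝓡 n) x₁).symm hyz
    simp only [hT, (extChartAt (𝓡 n) x₁).left_inv (h1 hy.1),
      (extChartAt (𝓡 n) x₁).left_inv (h1 hz.1)] at this
    exact (extChartAt (𝓡 n) x₀).symm.injOn hy.2 hz.2 this
  have hsm : MeasurableSet s := measurableSet_extChartAt_symm_preimage x₀ hA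
  rw [himg, lintegral_image_eq_lintegral_abs_det_fderiv_mul volume hsm
    (f' := fun y => if h : y ∈ s then L ⟨y, h⟩ else 0)
    (fun y hy => by rw [dif_pos hy]; exact (hL ⟨y, hy⟩).1.hasFDerivWithinAt) hinj]
  refine setLIntegral_congr_fun hsm fun y hy => ?_
  simp only [hy, dif_pos]
  rw [← ENNReal.ofReal_mul (abs_nonneg _), (hL ⟨y, hy⟩).2]

theorem chartVolume_inter_source (x₀ : M) {A : Set M} (hA : MeasurableSet A) :
    chartVolume (n := n) x₀ (A ∩ (extChartAt (𝓡 n) x₀).source) = chartVolume (n := n) x₀ A := by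
  rw [chartVolume_apply _ hA,
    chartVolume_apply _ (hA.inter (isOpen_extChartAt_source x₀).measurableSet)]
  congr 2
  ext y
  constructor
  · rintro ⟨h1, h2⟩
    exact ⟨h1.1, h2⟩
  · rintro ⟨h1, h2⟩
    exact ⟨⟨h1, (extChartAt (𝓡 n) x₀).map_target h2⟩, h2⟩

/-- A supremum of measures is not computed set by set, so it is bounded by one explicit measure that
dominates every chart measure. -/
theorem riemVolume_restrict_source [IsManifold (𝓡 n) ∞ M] (x₀ : M) :
    (riemVolume n M).restrict (extChartAt (𝓡 n) x₀).source = chartVolume (n := n) x₀ := by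
  have hU : MeasurableSet (extChartAt (𝓡 n) x₀).source :=
    (isOpen_extChartAt_source x₀).measurableSet
  -- On the domain of the chart at `x₀` all chart measures are at most `chartVolume x₀`; off that
  -- domain the trivial bound `⊤` costs nothing after restriction.
  have hle : riemVolume n M ≤
      chartVolume (n := n) x₀ + (⊤ : Measure M).restrict (extChartAt (𝓡 n) x₀).sourceᶜ := by
    refine iSup_le fun x => Measure.le_iff.2 fun B hB => ?_
    rw [← measure_inter_add_sdiff B hU, Measure.add_apply]
    refine add_le_add ?_ ?_
    · rw [← chartVolume_inter_source x (hB.inter hU)]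
      rw [chartVolume_eq_of_subset (x₀ := x₀) ((hB.inter hU).inter
        (isOpen_extChartAt_source x).measurableSet)
        (fun z hz => hz.1.2) (fun z hz => hz.2)]
      exact measure_mono fun z hz => hz.1.1
    · rw [Measure.restrict_apply hB]
      exact (le_top : chartVolume (n := n) x ≤ ⊤) _
  refine Measure.ext fun A hA => ?_
  rw [Measure.restrict_apply hA, ← chartVolume_inter_source x₀ hA]
  refine le_antisymm ((hle _).trans ?_) ((le_iSup (fun x : M => chartVolume (n := n) x) x₀) _)
  rw [Measure.add_apply, Measure.restrict_apply (hA.inter hU)]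
  have : A ∩ (extChartAt (𝓡 n) x₀).source ∩ (extChartAt (𝓡 n) x₀).sourceᶜ = ∅ := by
    ext z
    simp +contextual
  rw [this, measure_empty, add_zero]

/-- The integral of a function that is carried by a chart domain. -/
theorem integral_riemVolume_eq [IsManifold (𝓡 n) ∞ M]
    [IsContMDiffRiemannianBundle (𝓡 n) ∞ (EuclideanSpace ℝ (Fin n))
      (fun x : M => TangentSpace (𝓡 n) x)] {x₀ : M} {f : M → ℝ} (hf : Continuous f)
    (hsupp : ∀ x ∉ (extChartAt (𝓡 n) x₀).source, f x = 0) :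
    ∫ x, f x ∂(riemVolume n M) = ∫ y in (extChartAt (𝓡 n) x₀).target,
      volDensity x₀ y * f ((extChartAt (𝓡 n) x₀).symm y) := by
  rw [← setIntegral_eq_integral_of_forall_compl_eq_zero hsupp, riemVolume_restrict_source,
    chartVolume_eq, integral_map (aemeasurable_extChartAt_symm x₀) hf.aestronglyMeasurable,
    integral_withDensity_eq_integral_toReal_smul₀]
  · refine setIntegral_congr_fun (isOpen_extChartAt_target x₀).measurableSet fun y hy => ?_
    simp [ENNReal.toReal_ofReal (volDensity_pos hy).le]
  · exact ((contDiffOn_volDensity x₀).continuousOn.aemeasurable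
      (isOpen_extChartAt_target x₀).measurableSet).ennreal_ofReal
  · exact Filter.Eventually.of_forall fun y => ENNReal.ofReal_lt_top

end Riemannian

end

/-! ### Existence of `-div(f ∇φ)` by integration by parts -/

section
theorem integrable_of_support_subset_isCompact {E : Type*} [TopologicalSpace E] [T2Space E]
    [MeasurableSpace E] [OpensMeasurableSpace E] {μ : Measure E} [IsFiniteMeasureOnCompacts μ]
    {g : E → ℝ} {K : Set E} (hK : IsCompact K) (hg : ContinuousOn g K) (hz : ∀ y ∉ K, g y = 0) :
    Integrable g μ := by
  rw [← integrableOn_iff_integrable_of_support_subset (s := K)]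
  · exact hg.integrableOn_compact hK
  · exact fun y hy => by_contra fun h => hy (hz y h)

variable {n : ℕ} {M : Type*} [TopologicalSpace M] [ChartedSpace (EuclideanSpace ℝ (Fin n)) M]

theorem SmoothFn.sum_apply {ι : Type*} (t : Finset ι) (f : ι → SmoothFn n M) (x : M) :
    (∑ i ∈ t, f i) x = ∑ i ∈ t, f i x := by
  classical
  induction t using Finset.induction_on with
  | empty => simp
  | insert i t hi ih => rw [Finset.sum_insert hi, Finset.sum_insert hi, SmoothFn.add_apply, ih]

theorem isCompact_image_tsupport [CompactSpace M] {x₀ : M} {f : SmoothFn n M}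
    (hf : tsupport f ⊆ (extChartAt (𝓡 n) x₀).source) :
    IsCompact (extChartAt (𝓡 n) x₀ '' tsupport f) :=
  (isClosed_tsupport _).isCompact.image_of_continuousOn ((continuousOn_extChartAt x₀).mono hf)

variable [IsManifold (𝓡 n) ∞ M]

theorem contDiffOn_comp_extChartAt_symm (ψ : SmoothFn n M) (x₀ : M) :
    ContDiffOn ℝ ∞ (fun y => ψ ((extChartAt (𝓡 n) x₀).symm y)) (extChartAt (𝓡 n) x₀).target := by
  rw [← contMDiffOn_iff_contDiffOn]
  exact ψ.contMDiff.comp_contMDiffOn (contMDiffOn_extChartAt_symm x₀)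

theorem mvfderiv_coordFrame_symm (ψ : SmoothFn n M) {x₀ : M} {y : EuclideanSpace ℝ (Fin n)}
    (hy : y ∈ (extChartAt (𝓡 n) x₀).target) (i : Fin n) :
    mvfderiv (𝓡 n) ψ ((extChartAt (𝓡 n) x₀).symm y)
        (coordFrame n x₀ i ((extChartAt (𝓡 n) x₀).symm y)) =
      fderiv ℝ (fun z => ψ ((extChartAt (𝓡 n) x₀).symm z)) y (EuclideanSpace.single i 1) := by
  have h := (ψ.contMDiff.mdifferentiable (by simp)
    ((extChartAt (𝓡 n) x₀).symm y)).hasMFDerivAt.comp y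
    (mdifferentiableAt_extChartAt_symm hy).hasMFDerivAt
  have e := (mfderiv_eq_fderiv (𝕜 := ℝ) (E' := ℝ)
    (f := fun z => ψ ((extChartAt (𝓡 n) x₀).symm z)) (x := y)).symm
  rw [coordFrame_symm_eq_mfderiv hy]
  exact (congrArg (fun L : EuclideanSpace ℝ (Fin n) →L[ℝ] ℝ => L (EuclideanSpace.single i 1))
    (e.trans h.mfderiv)).symm

section Riemannian

variable [RiemannianBundle (fun x : M => TangentSpace (𝓡 n) x)]

/-- The components of `√(det g_ij) f ∇φ` in the chart at `x₀`, extended by zero. -/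
def chartField (x₀ : M) (f φ : SmoothFn n M) (j : Fin n) : EuclideanSpace ℝ (Fin n) → ℝ :=
  (extChartAt (𝓡 n) x₀).target.indicator fun y =>
    volDensity x₀ y * f ((extChartAt (𝓡 n) x₀).symm y) *
      ∑ i, (frameGram n x₀ ((extChartAt (𝓡 n) x₀).symm y))⁻¹ i j *
        fderiv ℝ (fun z => φ ((extChartAt (𝓡 n) x₀).symm z)) y (EuclideanSpace.single i 1)

theorem chartField_eq_zero {x₀ : M} {f φ : SmoothFn n M} {j : Fin n} {y : EuclideanSpace ℝ (Fin n)}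
    (hy : y ∉ extChartAt (𝓡 n) x₀ '' tsupport f) : chartField x₀ f φ j y = 0 := by
  by_cases h : y ∈ (extChartAt (𝓡 n) x₀).target
  · have : f ((extChartAt (𝓡 n) x₀).symm y) = 0 := by
      by_contra hne
      exact hy ⟨_, subset_tsupport _ hne, (extChartAt (𝓡 n) x₀).right_inv h⟩
    rw [chartField, indicator_of_mem h, this]
    simp
  · exact indicator_of_notMem h _

variable [CompactSpace M] [IsContMDiffRiemannianBundle (𝓡 n) ∞ (EuclideanSpace ℝ (Fin n))
  (fun x : M => TangentSpace (𝓡 n) x)]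

/-- The target and the complement of the compact image of `tsupport f` are open and cover the space:
on the first the formula is smooth, on the second the field vanishes. -/
theorem contDiff_chartField {x₀ : M} {f : SmoothFn n M}
    (hf : tsupport f ⊆ (extChartAt (𝓡 n) x₀).source) (φ : SmoothFn n M) (j : Fin n) :
    ContDiff ℝ ∞ (chartField x₀ f φ j) := by
  rw [contDiff_iff_contDiffAt]
  intro y
  have ho := isOpen_extChartAt_target (I := 𝓡 n) x₀
  by_cases hy : y ∈ (extChartAt (𝓡 n) x₀).target
  · have hy' := ho.mem_nhds hy
    have hx : (extChartAt (𝓡 n) x₀).symm y ∈ (chartAt (EuclideanSpace ℝ (Fin n)) x₀).source := by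
      simpa using (extChartAt (𝓡 n) x₀).map_target hy
    have h : ContDiffAt ℝ ∞ (fun y => volDensity x₀ y * f ((extChartAt (𝓡 n) x₀).symm y) *
      ∑ i, (frameGram n x₀ ((extChartAt (𝓡 n) x₀).symm y))⁻¹ i j *
        fderiv ℝ (fun z => φ ((extChartAt (𝓡 n) x₀).symm z)) y (EuclideanSpace.single i 1)) y := by
      refine (((contDiffOn_volDensity x₀).contDiffAt hy').mul
        ((contDiffOn_comp_extChartAt_symm f x₀).contDiffAt hy')).mul
        (ContDiffAt.sum fun i _ => ContDiffAt.mul ?_ ?_)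
      · rw [← contMDiffAt_iff_contDiffAt]
        exact (contMDiffAt_inv (contMDiffAt_frameGram hx) (frameGram_det_pos hx).ne' i j).comp y
          ((contMDiffOn_extChartAt_symm x₀).contMDiffAt hy')
      · exact (((contDiffOn_comp_extChartAt_symm φ x₀).fderiv_of_isOpen ho
          (m := ∞) (by simp)).contDiffAt hy').clm_apply contDiffAt_const
    refine h.congr_of_eventuallyEq ?_
    filter_upwards [hy'] with z hz
    exact indicator_of_mem hz _
  · have hK := (isCompact_image_tsupport hf).isClosed.isOpen_compl
    have hyK : y ∈ (extChartAt (𝓡 n) x₀ '' tsupport f)ᶜ := by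
      rintro ⟨x, hx, rfl⟩
      exact hy ((extChartAt (𝓡 n) x₀).map_source (hf hx))
    refine (contDiffAt_const (c := (0 : ℝ))).congr_of_eventuallyEq ?_
    filter_upwards [hK.mem_nhds hyK] with z hz
    exact chartField_eq_zero hz

/-- In coordinates the divergence is `(√g)⁻¹ ∂_j (√g f g^{ij} ∂_i φ)`. The field has compact support
in the chart, so integration by parts leaves no boundary term. -/
theorem exists_divergence_chart (x₀ : M) [MeasurableSpace M] [BorelSpace M] (f : SmoothFn n M)
    (hf : tsupport f ⊆ (extChartAt (𝓡 n) x₀).source) (φ : SmoothFn n M) :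
    ∃ V : SmoothFn n M, ∀ ψ : SmoothFn n M, ∫ x, V x * ψ x ∂(riemVolume n M)
      = ∫ x, f x * gradInner n φ ψ x ∂(riemVolume n M) := by
  classical
  set Φ := extChartAt (𝓡 n) x₀ with hΦ
  set X := chartField x₀ f φ with hX
  set K := Φ '' tsupport f with hKdef
  have hKc : IsCompact K := isCompact_image_tsupport hf
  have hKt : K ⊆ Φ.target := by
    rintro _ ⟨x, hx, rfl⟩
    exact Φ.map_source (hf hx)
  have ho : IsOpen Φ.target := isOpen_extChartAt_target x₀
  have hXs : ∀ j, ContDiff ℝ ∞ (X j) := fun j => contDiff_chartField hf φ j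
  have hX0 : ∀ j, ∀ y ∉ K, X j y = 0 := fun j y hy => chartField_eq_zero hy
  have hdX : ∀ j, ContDiff ℝ ∞ fun y => fderiv ℝ (X j) y (EuclideanSpace.single j 1) := fun j =>
    ((hXs j).fderiv_right (m := ∞) (by simp)).clm_apply contDiff_const
  have hdX0 : ∀ j, ∀ y ∉ K, fderiv ℝ (X j) y (EuclideanSpace.single j 1) = 0 := by
    intro j y hy
    have : X j =ᶠ[𝓝 y] fun _ => 0 := by
      filter_upwards [hKc.isClosed.isOpen_compl.mem_nhds hy] with z hz
      exact hX0 j z hz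
    rw [this.fderiv_eq]
    simp
  set V₀ : M → ℝ := Φ.source.indicator fun x =>
    -((volDensity x₀ (Φ x))⁻¹ * ∑ j, fderiv ℝ (X j) (Φ x) (EuclideanSpace.single j 1)) with hV₀
  have hV0 : ∀ x ∉ tsupport f, V₀ x = 0 := by
    intro x hx
    by_cases hxs : x ∈ Φ.source
    · have hK' : Φ x ∉ K := by
        rintro ⟨x', hx', h⟩
        exact hx (Φ.injOn (hf hx') hxs h ▸ hx')
      rw [hV₀, indicator_of_mem hxs, Finset.sum_eq_zero fun j _ => hdX0 j _ hK']
      simp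
    · exact indicator_of_notMem hxs _
  have hV : ContMDiff (𝓡 n) 𝓘(ℝ, ℝ) ∞ V₀ := by
    intro x
    by_cases hxs : x ∈ Φ.source
    · have h : ContDiffAt ℝ ∞ (fun y => -((volDensity x₀ y)⁻¹ *
          ∑ j, fderiv ℝ (X j) y (EuclideanSpace.single j 1))) (Φ x) := by
        have hy := Φ.map_source hxs
        refine ((((contDiffOn_volDensity x₀).contDiffAt (ho.mem_nhds hy)).inv
          (volDensity_pos hy).ne').mul ?_).neg
        exact ContDiffAt.sum fun j _ => (hdX j).contDiffAt
      have h2 : ContMDiffAt (𝓡 n) 𝓘(ℝ, EuclideanSpace ℝ (Fin n)) ∞ Φ x :=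
        contMDiffAt_extChartAt' (by simpa [hΦ] using hxs)
      refine (h.contMDiffAt.comp x h2).congr_of_eventuallyEq ?_
      filter_upwards [(isOpen_extChartAt_source (I := 𝓡 n) x₀).mem_nhds hxs] with z hz
      exact indicator_of_mem hz _
    · refine (contMDiffAt_const (c := (0 : ℝ))).congr_of_eventuallyEq ?_
      filter_upwards [(isClosed_tsupport f).isOpen_compl.mem_nhds fun h => hxs (hf h)] with z hz
      exact hV0 z hz
  refine ⟨⟨V₀, hV⟩, fun ψ => ?_⟩
  set ψ' : EuclideanSpace ℝ (Fin n) → ℝ := fun y => ψ (Φ.symm y) with hψ'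
  have hψs : ContDiffOn ℝ ∞ ψ' Φ.target := contDiffOn_comp_extChartAt_symm ψ x₀
  have hdψ : ∀ j, ContinuousOn (fun y => fderiv ℝ ψ' y (EuclideanSpace.single j 1)) Φ.target :=
    fun j => ((hψs.fderiv_of_isOpen ho (m := ∞) (by simp)).continuousOn).clm_apply
      continuousOn_const
  have hi1 : ∀ j, Integrable fun y => X j y * fderiv ℝ ψ' y (EuclideanSpace.single j 1) :=
    fun j => integrable_of_support_subset_isCompact hKc
      ((hXs j).continuous.continuousOn.mul ((hdψ j).mono hKt)) fun y hy => by simp [hX0 j y hy]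
  have hi2 : ∀ j, Integrable fun y => fderiv ℝ (X j) y (EuclideanSpace.single j 1) * ψ' y :=
    fun j => integrable_of_support_subset_isCompact hKc
      ((hdX j).continuous.continuousOn.mul (hψs.continuousOn.mono hKt))
      fun y hy => by simp [hdX0 j y hy]
  have hi3 : ∀ j, Integrable fun y => X j y * ψ' y :=
    fun j => integrable_of_support_subset_isCompact hKc
      ((hXs j).continuous.continuousOn.mul (hψs.continuousOn.mono hKt))
      fun y hy => by simp [hX0 j y hy]
  have hparts : ∀ j, ∫ y, X j y * fderiv ℝ ψ' y (EuclideanSpace.single j 1) =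
      -∫ y, fderiv ℝ (X j) y (EuclideanSpace.single j 1) * ψ' y := by
    intro j
    refine integral_mul_fderiv_eq_neg_fderiv_mul_of_integrable (hi2 j) (hi1 j) (hi3 j)
      (fun y _ => (hXs j).differentiable (by simp) y) fun y hy => ?_
    -- `ψ'` is known to be smooth only on the chart target, but its differentiability is needed only
    -- on the closed support of the field, which lies in `K`.
    have hyK : y ∈ K := closure_minimal (fun z hz => by_contra fun h =>
      Function.mem_support.1 hz (hX0 j z h))
      hKc.isClosed hy
    exact (hψs.contDiffAt (ho.mem_nhds (hKt hyK))).differentiableAt (by simp)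
  have hl : ∫ x, V₀ x * ψ x ∂(riemVolume n M) =
      ∫ y, -∑ j, fderiv ℝ (X j) y (EuclideanSpace.single j 1) * ψ' y := by
    rw [integral_riemVolume_eq (x₀ := x₀) (f := fun x => V₀ x * ψ x)
      (hV.continuous.mul ψ.contMDiff.continuous)
      fun x hx => by rw [hV0 x fun h => hx (hf h), zero_mul]]
    refine Eq.trans ?_ (setIntegral_eq_integral_of_forall_compl_eq_zero (s := Φ.target)
      fun y hy => by simp [hdX0 _ y fun h => hy (hKt h)])
    refine setIntegral_congr_fun ho.measurableSet fun y hy => ?_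
    have hJ := (volDensity_pos hy).ne'
    simp only [hV₀, indicator_of_mem (Φ.map_target hy), ← hΦ, Φ.right_inv hy, ← Finset.sum_mul]
    field_simp
    rfl
  have hr : ∫ x, f x * gradInner n φ ψ x ∂(riemVolume n M) =
      ∫ y, ∑ j, X j y * fderiv ℝ ψ' y (EuclideanSpace.single j 1) := by
    rw [integral_riemVolume_eq (x₀ := x₀) (f := fun x => f x * gradInner n φ ψ x)
      (f.contMDiff.continuous.mul (gradPair φ ψ).contMDiff.continuous)
      fun x hx => by rw [image_eq_zero_of_notMem_tsupport fun h => hx (hf h), zero_mul]]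
    refine Eq.trans ?_ (setIntegral_eq_integral_of_forall_compl_eq_zero (s := Φ.target)
      fun y hy => Finset.sum_eq_zero fun j _ => by rw [hX0 _ y fun h => hy (hKt h), zero_mul])
    refine setIntegral_congr_fun ho.measurableSet fun y hy => ?_
    have hx : Φ.symm y ∈ (chartAt (EuclideanSpace ℝ (Fin n)) x₀).source := by
      simpa [hΦ] using Φ.map_target hy
    simp only [← hΦ, gradInner_eq_sum φ ψ hx, hX, chartField]
    rw [Finset.sum_comm, Finset.mul_sum, Finset.mul_sum]
    refine Finset.sum_congr rfl fun j _ => ?_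
    rw [Finset.mul_sum, Finset.mul_sum, indicator_of_mem (show y ∈ Φ.target from hy),
      Finset.mul_sum, Finset.sum_mul]
    refine Finset.sum_congr rfl fun i _ => ?_
    rw [mvfderiv_coordFrame_symm φ hy, mvfderiv_coordFrame_symm ψ hy]
    ring
  change ∫ x, V₀ x * ψ x ∂(riemVolume n M) = _
  rw [hl, hr, integral_neg, integral_finsetSum _ fun j _ => hi2 j,
    integral_finsetSum _ fun j _ => hi1 j, ← Finset.sum_neg_distrib]
  exact Finset.sum_congr rfl fun j _ => (hparts j).symm

/-- A partition of unity splits `f` into finitely many pieces carried by charts, and the defining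
relation is linear in `f`. -/
theorem exists_isTangentOf [T2Space M] [MeasurableSpace M] [BorelSpace M]
    [IsFiniteMeasure (riemVolume n M)] (f φ : SmoothFn n M) : ∃ V, IsTangentOf f φ V := by
  obtain ⟨χ, hχ⟩ := SmoothPartitionOfUnity.exists_isSubordinate_chartAt_source (𝓡 n) M
  have hfin : {i | (Function.support (χ i)).Nonempty}.Finite :=
    χ.locallyFinite.finite_nonempty_of_compact
  have hsum : ∀ x, ∑ i ∈ hfin.toFinset, χ i x = 1 := by
    intro x
    rw [← χ.sum_eq_one (mem_univ x), finsum_eq_sum_of_support_subset]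
    intro i hi
    simp only [Finite.coe_toFinset, mem_ofPred_eq]
    exact ⟨x, hi⟩
  have hex : ∀ i, ∃ V : SmoothFn n M, ∀ ψ : SmoothFn n M, ∫ x, V x * ψ x ∂(riemVolume n M)
      = ∫ x, (χ i * f) x * gradInner n φ ψ x ∂(riemVolume n M) := by
    intro i
    refine exists_divergence_chart i (χ i * f) ?_ φ
    rw [extChartAt_source]
    exact (tsupport_mul_subset_left (f := χ i) (g := f)).trans (hχ i)
  choose V hV using hex
  refine ⟨∑ i ∈ hfin.toFinset, V i, fun ψ => ?_⟩
  have h1 : ∀ x, (∑ i ∈ hfin.toFinset, V i) x * ψ x = ∑ i ∈ hfin.toFinset, (V i * ψ) x := by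
    intro x
    rw [SmoothFn.sum_apply, Finset.sum_mul]
    rfl
  have h2 : ∀ x, f x * gradInner n φ ψ x =
      ∑ i ∈ hfin.toFinset, (χ i * f * gradPair φ ψ) x := by
    intro x
    have : ∑ i ∈ hfin.toFinset, (χ i * f * gradPair φ ψ) x =
        (∑ i ∈ hfin.toFinset, χ i x) * (f x * gradInner n φ ψ x) := by
      rw [Finset.sum_mul]
      exact Finset.sum_congr rfl fun i _ => mul_assoc _ _ _
    rw [this, hsum, one_mul]
  simp only [h1, h2]
  rw [integral_finsetSum _ fun i _ => SmoothFn.integrable _ _,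
    integral_finsetSum _ fun i _ => SmoothFn.integrable _ _]
  exact Finset.sum_congr rfl fun i _ => hV i ψ

end Riemannian

end

/-! ### Chain rule and second variation of the functional -/

section
/-- Symmetry of mixed partial derivatives for functions of two real variables. -/
theorem hasDerivAt_deriv_partial {φ : ℝ × ℝ → ℝ} (hφ : ContDiff ℝ ∞ φ) (s y : ℝ) :
    HasDerivAt (fun r => deriv (fun z => φ (r, z)) y)
      (deriv (fun z => deriv (fun r => φ (r, z)) s) y) s := by
  simpa using hasDerivAt_fderiv_partial (s := s) (y := y) hφ.contDiffAt (1 : ℝ)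

theorem exists_smooth_truncation {r : ℝ} (hr : 0 < r) :
    ∃ χ : ℝ → ℝ, ContDiff ℝ ∞ χ ∧ (∀ ε, |χ ε| ≤ r) ∧ χ =ᶠ[𝓝 0] id := by
  let b : ContDiffBump (0 : ℝ) := ⟨r / 2, r, by positivity, by linarith⟩
  refine ⟨fun ε => b ε * ε, b.contDiff.mul contDiff_id, fun ε => ?_, ?_⟩
  · rw [abs_mul, abs_of_nonneg b.nonneg]
    by_cases h : |ε| ≤ r
    · exact (mul_le_of_le_one_left (abs_nonneg ε) b.le_one).trans h
    · have : b ε = 0 := b.zero_of_le_dist (by simpa [b] using (not_le.1 h).le)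
      simp [this, hr.le]
  · filter_upwards [b.eventuallyEq_one] with ε hε
    simp [hε]

variable {n : ℕ} {M : Type*} [TopologicalSpace M] [ChartedSpace (EuclideanSpace ℝ (Fin n)) M]

/-- A smooth curve of functions that is bounded below by a positive constant. -/
structure IsPosPath (γ : ℝ → SmoothFn n M) : Prop where
  smooth : IsSmoothPath γ
  bound : ∃ m : ℝ, 0 < m ∧ ∀ s x, m ≤ γ s x

theorem IsPosPath.pos {γ : ℝ → SmoothFn n M} (hγ : IsPosPath γ) (s : ℝ) (x : M) : 0 < γ s x := by
  obtain ⟨m, hm, h⟩ := hγ.bound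
  exact hm.trans_le (h s x)

theorem SmoothFn.exists_abs_le [CompactSpace M] (h : SmoothFn n M) :
    ∃ C, 0 ≤ C ∧ ∀ x, |h x| ≤ C := by
  obtain ⟨C, hC⟩ := isCompact_univ.exists_bound_of_continuousOn h.contMDiff.continuous.continuousOn
  exact ⟨max C 0, le_max_right _ _, fun x => (hC x (mem_univ x)).trans (le_max_left _ _)⟩

/-- `γ s + ε • h` need stay positive only for small `ε`. Replacing `ε` by a bounded `χ ε` with the
same germ at `0` keeps it positive for all `ε`, hence in the domain of the functional. -/
theorem IsPosPath.exists_truncation [CompactSpace M] {γ : ℝ → SmoothFn n M} (hγ : IsPosPath γ)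
    (h : SmoothFn n M) : ∃ χ : ℝ → ℝ, ContDiff ℝ ∞ χ ∧ χ =ᶠ[𝓝 0] id ∧
      ∃ m : ℝ, 0 < m ∧ ∀ s ε x, m ≤ (γ s + χ ε • h) x := by
  obtain ⟨m, hm, hb⟩ := hγ.bound
  obtain ⟨C, hC, hC'⟩ := h.exists_abs_le
  -- This radius makes `|χ ε * h x|` at most `m / 2`; the summand `1` covers the case `C = 0`.
  obtain ⟨χ, h1, h2, h3⟩ := exists_smooth_truncation (r := m / (2 * (C + 1))) (by positivity)
  refine ⟨χ, h1, h3, m / 2, by positivity, fun s ε x => ?_⟩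
  have h4 : |χ ε * h x| ≤ m / (2 * (C + 1)) * (C + 1) := by
    rw [abs_mul]
    exact mul_le_mul (h2 ε) ((hC' x).trans (by linarith)) (abs_nonneg _) (by positivity)
  have h5 : m / (2 * (C + 1)) * (C + 1) = m / 2 := by
    field_simp
  have h6 := (abs_le.1 (h4.trans_eq h5)).1
  have := hb s x
  simp only [SmoothFn.add_apply, SmoothFn.smul_apply]
  linarith

theorem isPosPath_const [CompactSpace M] {ρ : SmoothFn n M} (hρ : ∀ x, 0 < ρ x) :
    IsPosPath fun _ => ρ := by
  refine ⟨IsSmoothPath.const ρ, ?_⟩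
  rcases isEmpty_or_nonempty M with h | h
  · exact ⟨1, one_pos, fun _ x => isEmptyElim x⟩
  · obtain ⟨x₀, -, hx₀⟩ := isCompact_univ.exists_isMinOn univ_nonempty
      ρ.contMDiff.continuous.continuousOn
    exact ⟨ρ x₀, hρ x₀, fun _ x => hx₀ (mem_univ x)⟩

section Riemannian

variable [RiemannianBundle (fun x : M => TangentSpace (𝓡 n) x)] [MeasurableSpace M]

theorem hasL2Gradient_firstVariation {D : Set (SmoothFn n M)} {F : SmoothFn n M → ℝ}
    (hF : IsSmoothFunctional D F) {u : SmoothFn n M} (hu : u ∈ D) :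
    HasL2Gradient F u (firstVariation F u) := by
  have h := hF.exists_gradient u hu
  rw [firstVariation, dif_pos h]
  exact h.choose_spec

theorem hasDerivAt_line {D : Set (SmoothFn n M)} {F : SmoothFn n M → ℝ}
    (hF : IsSmoothFunctional D F) {u h : SmoothFn n M} {ε₀ : ℝ} (hu : u + ε₀ • h ∈ D) :
    HasDerivAt (fun ε : ℝ => F (u + ε • h))
      (∫ x, firstVariation F (u + ε₀ • h) x * h x ∂(riemVolume n M)) ε₀ := by
  have h1 := hasL2Gradient_firstVariation hF hu h
  rw [← sub_self ε₀] at h1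
  have h2 := HasDerivAt.comp_sub_const ε₀ ε₀ h1
  refine h2.congr_of_eventuallyEq (Filter.Eventually.of_forall fun ε => ?_)
  simp only
  rw [add_assoc, ← add_smul]
  congr 3
  ring

/-- Smoothness is assumed for families over Euclidean spaces; a curve is one over `EuclideanSpace ℝ
(Fin 1)`. -/
theorem isSmoothPath_firstVariation {D : Set (SmoothFn n M)} {F : SmoothFn n M → ℝ}
    (hF : IsSmoothFunctional D F) {γ : ℝ → SmoothFn n M} (hγ : IsSmoothPath γ)
    (hD : ∀ s, γ s ∈ D) : IsSmoothPath fun s => firstVariation F (γ s) := by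
  have hc : IsSmoothFamily (fun v : EuclideanSpace ℝ (Fin 1) => γ (v 0)) := by
    refine ContMDiff.comp hγ (ContMDiff.prodMk ?_ contMDiff_snd)
    exact (show ContDiff ℝ ∞ fun v : EuclideanSpace ℝ (Fin 1) => v 0 by fun_prop).contMDiff.comp
      contMDiff_fst
  have h := hF.smooth_firstVariation 1 _ hc
  have hu : ({u : EuclideanSpace ℝ (Fin 1) | γ (u 0) ∈ D} ×ˢ (univ : Set M)) = univ := by
    ext p
    simp [hD]
  rw [hu, contMDiffOn_univ] at h
  have h2 : ContMDiff (𝓘(ℝ, ℝ).prod (𝓡 n)) ((𝓡 1).prod (𝓡 n)) ∞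
      (fun p : ℝ × M => (p.1 • EuclideanSpace.single (0 : Fin 1) (1 : ℝ), p.2)) := by
    refine ContMDiff.prodMk ?_ contMDiff_snd
    exact (show ContDiff ℝ ∞ fun s : ℝ => s • EuclideanSpace.single (0 : Fin 1) (1 : ℝ) by
      fun_prop).contMDiff.comp contMDiff_fst
  have h3 := h.comp h2
  simpa [IsSmoothPath, Function.comp_def] using! h3

theorem contDiff_functional_comp {D : Set (SmoothFn n M)} {F : SmoothFn n M → ℝ}
    (hF : IsSmoothFunctional D F) {c : ℝ → ℝ → SmoothFn n M}
    (hc : ContMDiff ((𝓘(ℝ, ℝ).prod 𝓘(ℝ, ℝ)).prod (𝓡 n)) 𝓘(ℝ, ℝ) ∞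
      fun p : (ℝ × ℝ) × M => c p.1.1 p.1.2 p.2)
    (hD : ∀ s ε, c s ε ∈ D) : ContDiff ℝ ∞ fun p : ℝ × ℝ => F (c p.1 p.2) := by
  have hc' : IsSmoothFamily (fun v : EuclideanSpace ℝ (Fin 2) => c (v 0) (v 1)) := by
    refine ContMDiff.comp hc (ContMDiff.prodMk (ContMDiff.prodMk ?_ ?_) contMDiff_snd)
    · exact (show ContDiff ℝ ∞ fun v : EuclideanSpace ℝ (Fin 2) => v 0 by fun_prop).contMDiff.comp
        contMDiff_fst
    · exact (show ContDiff ℝ ∞ fun v : EuclideanSpace ℝ (Fin 2) => v 1 by fun_prop).contMDiff.comp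
        contMDiff_fst
  have h := hF.smooth 2 _ hc'
  have hu : {u : EuclideanSpace ℝ (Fin 2) | c (u 0) (u 1) ∈ D} = univ := by
    ext p
    simp [hD]
  rw [hu, contDiffOn_univ] at h
  have h2 : ContDiff ℝ ∞ fun p : ℝ × ℝ => p.1 • EuclideanSpace.single (0 : Fin 2) (1 : ℝ)
      + p.2 • EuclideanSpace.single (1 : Fin 2) (1 : ℝ) := by fun_prop
  simpa [Function.comp_def] using! h.comp h2

variable [CompactSpace M] [BorelSpace M] [IsFiniteMeasure (riemVolume n M)] [IsManifold (𝓡 n) ∞ M]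

/-- The chain rule for `F` along smooth curves of positive functions. -/
theorem hasDerivAt_functional_path {D : Set (SmoothFn n M)} {F : SmoothFn n M → ℝ}
    (hF : IsSmoothFunctional D F) {γ γ' : ℝ → SmoothFn n M} (hγ : IsPosPath γ)
    (hγ' : IsPathDeriv γ γ') (s₀ : ℝ) :
    HasDerivAt (fun s => F (γ s))
      (∫ x, firstVariation F (γ s₀) x * γ' s₀ x ∂(riemVolume n M)) s₀ := by
  -- The segments from `γ s₀` to `γ s`, run through with parameter `sin² τ`: every `c τ s` is a
  -- convex combination of positive functions, for all real `τ`. Moving in `τ` stays on a line,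
  -- where the gradient is available.
  set c : ℝ → ℝ → SmoothFn n M := fun τ s => γ s₀ + Real.sin τ ^ 2 • (γ s - γ s₀) with hc
  have hpos : ∀ τ s x, 0 < c τ s x := by
    intro τ s x
    have h1 : c τ s x = Real.cos τ ^ 2 * γ s₀ x + Real.sin τ ^ 2 * γ s x := by
      simp only [hc, SmoothFn.add_apply, SmoothFn.smul_apply, SmoothFn.sub_apply]
      rw [Real.cos_sq']
      ring
    rw [h1]
    have h2 := hγ.pos s₀ x
    have h3 := hγ.pos s x
    rcases eq_or_ne (Real.cos τ) 0 with h | h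
    · have : Real.sin τ ^ 2 = 1 := by rw [Real.sin_sq, h]; ring
      simpa [h, this] using h3
    · have : 0 < Real.cos τ ^ 2 := by positivity
      have := mul_pos this h2
      have : 0 ≤ Real.sin τ ^ 2 * γ s x := by positivity
      linarith
  have hD : ∀ τ s, c τ s ∈ D := fun τ s => hF.pos_mem _ (hpos τ s)
  have hcs : ContMDiff ((𝓘(ℝ, ℝ).prod 𝓘(ℝ, ℝ)).prod (𝓡 n)) 𝓘(ℝ, ℝ) ∞
      fun p : (ℝ × ℝ) × M => c p.1.1 p.1.2 p.2 := by
    have h1 : ContMDiff ((𝓘(ℝ, ℝ).prod 𝓘(ℝ, ℝ)).prod (𝓡 n)) 𝓘(ℝ, ℝ) ∞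
        fun p : (ℝ × ℝ) × M => γ s₀ p.2 := (γ s₀).contMDiff.comp contMDiff_snd
    have h2 : ContMDiff ((𝓘(ℝ, ℝ).prod 𝓘(ℝ, ℝ)).prod (𝓡 n)) 𝓘(ℝ, ℝ) ∞
        fun p : (ℝ × ℝ) × M => γ p.1.2 p.2 :=
      ContMDiff.comp hγ.smooth ((contMDiff_snd.comp contMDiff_fst).prodMk contMDiff_snd)
    have h3 : ContMDiff ((𝓘(ℝ, ℝ).prod 𝓘(ℝ, ℝ)).prod (𝓡 n)) 𝓘(ℝ, ℝ) ∞
        fun p : (ℝ × ℝ) × M => Real.sin p.1.1 ^ 2 :=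
      (Real.contDiff_sin.pow 2).contMDiff.comp (contMDiff_fst.comp contMDiff_fst)
    exact h1.add (h3.mul (h2.sub h1))
  have hsm := contDiff_functional_comp hF hcs hD
  set m := ∫ x, firstVariation F (γ s₀) x * γ' s₀ x ∂(riemVolume n M) with hm
  have hτ : ∀ τ s, deriv (fun t => F (c t s)) τ = 2 * Real.sin τ * Real.cos τ *
      ∫ x, firstVariation F (c τ s) x * (γ s - γ s₀) x ∂(riemVolume n M) := by
    intro τ s
    have h1 := hasDerivAt_line hF (hD τ s)
    have h2 := h1.comp τ ((Real.hasDerivAt_sin τ).pow 2)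
    rw [HasDerivAt.deriv (f := fun t => F (c t s)) h2]
    push_cast
    ring
  -- At `s = s₀` the factor `γ s - γ s₀` vanishes and `c τ s₀ = γ s₀`, so the derivative of the
  -- first variation drops out.
  have hs : ∀ τ, HasDerivAt (fun s => deriv (fun t => F (c t s)) τ)
      (2 * Real.sin τ * Real.cos τ * m) s₀ := by
    intro τ
    simp only [hτ]
    refine HasDerivAt.const_mul _ ?_
    have hpath : IsSmoothPath (fun s => c τ s) :=
      (IsSmoothPath.const _).add ((hγ.smooth.sub (IsSmoothPath.const _)).smul contDiff_const)
    have hq := isSmoothPath_firstVariation hF hpath (hD τ)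
    obtain ⟨q', hq's, hq'⟩ := hq.exists_pathDeriv
    obtain ⟨g', hg's, hg'⟩ := hγ.smooth.exists_pathDeriv
    have hgg : ∀ x, g' s₀ x = γ' s₀ x := fun x => (hg' s₀ x).unique (hγ' s₀ x)
    have hg := hγ.smooth.sub (IsSmoothPath.const (γ s₀))
    have h4 := (hq'.mul (hg'.sub (IsPathDeriv.const (γ s₀)))).hasDerivAt_integral (riemVolume n M)
      (f := fun s => firstVariation F (c τ s) * (γ s - γ s₀))
      ((hq's.mul hg).add (hq.mul (hg's.sub (IsSmoothPath.const _)))) s₀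
    refine h4.congr_deriv ?_
    rw [hm]
    refine integral_congr_ae (Filter.Eventually.of_forall fun x => ?_)
    simp [hc, hgg]
  have hA : ∀ τ, HasDerivAt (fun t => deriv (fun s => F (c t s)) s₀)
      (2 * Real.sin τ * Real.cos τ * m) τ := by
    intro τ
    have h5 := hasDerivAt_deriv_partial hsm τ s₀
    rwa [(hs τ).deriv] at h5
  -- Exchanging the partials and integrating in `τ` from `0`, where the curve is constant in `s`, to
  -- `π / 2`, where it is `γ`, gives the derivative along `γ`.
  have hconst : ∀ τ, HasDerivAt
      (fun t => deriv (fun s => F (c t s)) s₀ - Real.sin t ^ 2 * m) 0 τ := by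
    intro τ
    refine ((hA τ).sub (((Real.hasDerivAt_sin τ).pow 2).mul_const m)).congr_deriv ?_
    push_cast
    ring
  have h6 := is_const_of_deriv_eq_zero (fun τ => (hconst τ).differentiableAt)
    (fun τ => (hconst τ).deriv) (Real.pi / 2) 0
  have h7 : (fun s => F (c (Real.pi / 2) s)) = fun s => F (γ s) := by
    ext s
    simp [hc]
  have h8 : (fun s => F (c 0 s)) = fun _ => F (γ s₀) := by
    ext s
    simp [hc]
  simp only [h7, h8, Real.sin_pi_div_two, Real.sin_zero, deriv_const] at h6
  have h9 : deriv (fun s => F (γ s)) s₀ = m := by linarith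
  have h10 : DifferentiableAt ℝ (fun s => F (γ s)) s₀ := by
    rw [← h7]
    exact ((hsm.differentiable (by simp)).comp
      (differentiable_const (Real.pi / 2) |>.prodMk differentiable_id)) s₀
  exact h9 ▸ h10.hasDerivAt

/-- `w` is the derivative of the first variation of `F` at `ρ` in the direction `h`. -/
def IsSecondVariation (F : SmoothFn n M → ℝ) (ρ h w : SmoothFn n M) : Prop :=
  ∃ Q Q' : ℝ → SmoothFn n M, IsSmoothPath Q ∧ IsSmoothPath Q' ∧ IsPathDeriv Q Q' ∧ Q' 0 = w ∧
    ∀ᶠ ε in 𝓝 (0 : ℝ), Q ε = firstVariation F (ρ + ε • h)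

omit [BorelSpace M] [IsFiniteMeasure (riemVolume n M)] in
theorem exists_isSecondVariation {D : Set (SmoothFn n M)} {F : SmoothFn n M → ℝ}
    (hF : IsSmoothFunctional D F) {ρ : SmoothFn n M} (hρ : ∀ x, 0 < ρ x) (h : SmoothFn n M) :
    ∃ w, IsSecondVariation F ρ h w := by
  obtain ⟨χ, h1, h2, m, hm, h3⟩ := (isPosPath_const hρ).exists_truncation h
  have hp : IsSmoothPath fun ε => ρ + χ ε • h :=
    (IsSmoothPath.const ρ).add ((IsSmoothPath.const h).smul h1)
  have hq := isSmoothPath_firstVariation hF hp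
    fun ε => hF.pos_mem _ fun x => hm.trans_le (h3 0 ε x)
  obtain ⟨Q', hQ's, hQ'⟩ := hq.exists_pathDeriv
  refine ⟨Q' 0, _, Q', hq, hQ's, hQ', rfl, ?_⟩
  filter_upwards [h2] with ε hε
  rw [hε, id]

/-- Both sides are mixed partials at `(s₀, 0)` of `F (γ s + χ ε • h)`, taken in the two orders. This
is the symmetry of `δ²F` along a curve. -/
theorem IsSecondVariation.integral_eq {D : Set (SmoothFn n M)} {F : SmoothFn n M → ℝ}
    (hF : IsSmoothFunctional D F) {γ γ' U' : ℝ → SmoothFn n M} (hγ : IsPosPath γ)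
    (hγ' : IsPathDeriv γ γ') (hU' : IsPathDeriv (fun s => firstVariation F (γ s)) U')
    {s₀ : ℝ} {h w : SmoothFn n M} (hw : IsSecondVariation F (γ s₀) h w) :
    ∫ x, U' s₀ x * h x ∂(riemVolume n M) = ∫ x, w x * γ' s₀ x ∂(riemVolume n M) := by
  obtain ⟨χ, h1, h2, m, hm, h3⟩ := hγ.exists_truncation h
  obtain ⟨Q, Q', hQs, hQ's, hQ', rfl, hQ⟩ := hw
  have hpos : ∀ ε, IsPosPath fun s => γ s + χ ε • h := fun ε =>
    ⟨hγ.smooth.add (IsSmoothPath.const _), m, hm, fun s x => h3 s ε x⟩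
  have hD : ∀ ε s, γ s + χ ε • h ∈ D := fun ε s => hF.pos_mem _ fun x => (hpos ε).pos s x
  have hcs : ContMDiff ((𝓘(ℝ, ℝ).prod 𝓘(ℝ, ℝ)).prod (𝓡 n)) 𝓘(ℝ, ℝ) ∞
      fun p : (ℝ × ℝ) × M => (γ p.1.2 + χ p.1.1 • h) p.2 := by
    have h4 : ContMDiff ((𝓘(ℝ, ℝ).prod 𝓘(ℝ, ℝ)).prod (𝓡 n)) 𝓘(ℝ, ℝ) ∞
        fun p : (ℝ × ℝ) × M => γ p.1.2 p.2 :=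
      ContMDiff.comp hγ.smooth ((contMDiff_snd.comp contMDiff_fst).prodMk contMDiff_snd)
    exact h4.add ((h1.contMDiff.comp (contMDiff_fst.comp contMDiff_fst)).mul
      (h.contMDiff.comp contMDiff_snd))
  have hsm := contDiff_functional_comp hF hcs hD
  have hε : ∀ s, deriv (fun ε => F (γ s + χ ε • h)) 0 =
      ∫ x, firstVariation F (γ s) x * h x ∂(riemVolume n M) := by
    intro s
    have h5 : (fun ε => F (γ s + χ ε • h)) =ᶠ[𝓝 0] fun ε => F (γ s + ε • h) := by
      filter_upwards [h2] with ε hε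
      rw [hε, id]
    rw [h5.deriv_eq]
    have h6 := hasDerivAt_line hF (u := γ s) (h := h) (ε₀ := 0)
      (by simpa using hF.pos_mem _ (hγ.pos s))
    simpa using h6.deriv
  have hs : ∀ ε, deriv (fun s => F (γ s + χ ε • h)) s₀ =
      ∫ x, firstVariation F (γ s₀ + χ ε • h) x * γ' s₀ x ∂(riemVolume n M) := by
    intro ε
    have h7 : IsPathDeriv (fun s => γ s + χ ε • h) (fun s => γ' s + 0) :=
      hγ'.add (IsPathDeriv.const _)
    simpa using (hasDerivAt_functional_path hF (hpos ε) h7 s₀).deriv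
  have h8 := hasDerivAt_deriv_partial hsm 0 s₀
  simp only [hε, hs] at h8
  obtain ⟨W', hW's, hW'⟩ := (isSmoothPath_firstVariation hF hγ.smooth
    fun s => hF.pos_mem _ (hγ.pos s)).exists_pathDeriv
  have hWU : ∀ x, W' s₀ x = U' s₀ x := fun x => (hW' s₀ x).unique (hU' s₀ x)
  have h9 := (hW'.mul (IsPathDeriv.const h)).hasDerivAt_integral (riemVolume n M)
    (((hW's.mul (IsSmoothPath.const h))).add ((isSmoothPath_firstVariation hF hγ.smooth
    fun s => hF.pos_mem _ (hγ.pos s)).mul (IsSmoothPath.const 0))) s₀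
  have h10 := (hQ'.mul (IsPathDeriv.const (γ' s₀))).hasDerivAt_integral (riemVolume n M)
    ((hQ's.mul (IsSmoothPath.const (γ' s₀))).add (hQs.mul (IsSmoothPath.const 0))) 0
  have h11 : (fun ε => ∫ x, firstVariation F (γ s₀ + χ ε • h) x * γ' s₀ x ∂(riemVolume n M))
      =ᶠ[𝓝 0] fun ε => ∫ x, (Q ε * γ' s₀) x ∂(riemVolume n M) := by
    filter_upwards [h2, hQ] with ε h12 h13
    rw [h13, h12]
    rfl
  have h14 := h8.unique (h10.congr_of_eventuallyEq h11)
  have h15 := HasDerivAt.deriv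
    (f := fun s => ∫ x, firstVariation F (γ s) x * h x ∂(riemVolume n M)) h9
  rw [h15] at h14
  simpa [hWU] using h14

/-- The preceding symmetry on the truncated line through `ρ` in the direction `k`. -/
theorem IsSecondVariation.symm {D : Set (SmoothFn n M)} {F : SmoothFn n M → ℝ}
    (hF : IsSmoothFunctional D F) {ρ h k w v : SmoothFn n M} (hρ : ∀ x, 0 < ρ x)
    (hw : IsSecondVariation F ρ h w) (hv : IsSecondVariation F ρ k v) :
    ∫ x, v x * h x ∂(riemVolume n M) = ∫ x, w x * k x ∂(riemVolume n M) := by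
  obtain ⟨χ, h1, h2, m, hm, h3⟩ := (isPosPath_const hρ).exists_truncation k
  have hp : IsSmoothPath fun ε => ρ + χ ε • k :=
    (IsSmoothPath.const ρ).add ((IsSmoothPath.const k).smul h1)
  have hpos : IsPosPath fun ε => ρ + χ ε • k := ⟨hp, m, hm, fun s x => h3 0 s x⟩
  obtain ⟨γ', hγ's, hγ'⟩ := hp.exists_pathDeriv
  obtain ⟨U', hU's, hU'⟩ := (isSmoothPath_firstVariation hF hp
    fun s => hF.pos_mem _ (hpos.pos s)).exists_pathDeriv
  have h0 : χ 0 = 0 := h2.eq_of_nhds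
  have hw' : IsSecondVariation F (ρ + χ 0 • k) h w := by simpa [h0] using hw
  have key := IsSecondVariation.integral_eq hF hpos hγ' hU' hw'
  obtain ⟨Q, Q', hQs, hQ's, hQ', rfl, hQ⟩ := hv
  have h4 : ∀ x, U' 0 x = Q' 0 x := fun x => by
    refine (hU' 0 x).unique ((hQ' 0 x).congr_of_eventuallyEq ?_)
    filter_upwards [h2, hQ] with ε h5 h6
    rw [h6, h5, id]
  have h5 : ∀ x, γ' 0 x = k x := fun x => by
    refine (hγ' 0 x).unique ?_
    have h6 : HasDerivAt (fun ε : ℝ => ρ x + ε * k x) (k x) 0 := by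
      simpa using ((hasDerivAt_id (0 : ℝ)).mul_const (k x)).const_add (ρ x)
    refine h6.congr_of_eventuallyEq ?_
    filter_upwards [h2] with ε h7
    simp [h7]
  simpa [h4, h5] using key

end Riemannian

end

/-! ### The flow in weak form: conservation, energy derivative, dissipation -/

section
variable {n : ℕ} {M : Type*} [TopologicalSpace M] [ChartedSpace (EuclideanSpace ℝ (Fin n)) M]
  [RiemannianBundle (fun x : M => TangentSpace (𝓡 n) x)] [MeasurableSpace M]

/-- The integral of a smooth function against the Riemannian volume. -/
def integ (f : SmoothFn n M) : ℝ := ∫ x, f x ∂(riemVolume n M)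

/-- A non-integrable function has integral `0`, so a density of mass `1` is integrable; by
compactness it is bounded below by a positive constant. -/
theorem isFiniteMeasure_riemVolume [CompactSpace M] {ρ : SmoothFn n M}
    (hρ : ρ ∈ densities n M) : IsFiniteMeasure (riemVolume n M) := by
  obtain ⟨m, hm, hb⟩ := (isPosPath_const hρ.1).bound
  have hi : Integrable (fun x => ρ x) (riemVolume n M) := by
    by_contra h
    have := integral_undef h
    rw [hρ.2] at this
    exact one_ne_zero this
  have h1 : Integrable (fun _ : M => m) (riemVolume n M) :=
    hi.mono aestronglyMeasurable_const (Filter.Eventually.of_forall fun x => by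
      rw [Real.norm_of_nonneg hm.le, Real.norm_of_nonneg (hρ.1 x).le]
      exact hb 0 x)
  exact (integrable_const_iff_isFiniteMeasure hm.ne').1 h1

variable [CompactSpace M] [BorelSpace M] [IsFiniteMeasure (riemVolume n M)]

theorem integ_add (f g : SmoothFn n M) : integ (f + g) = integ f + integ g :=
  integral_add (f.integrable _) (g.integrable _)

theorem integ_sub (f g : SmoothFn n M) : integ (f - g) = integ f - integ g :=
  integral_sub (f.integrable _) (g.integrable _)

omit [CompactSpace M] [BorelSpace M] [IsFiniteMeasure (riemVolume n M)] in
theorem integ_smul (c : ℝ) (f : SmoothFn n M) : integ (c • f) = c * integ f :=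
  integral_const_mul c _

theorem IsPathDeriv.hasDerivAt_integ {f f' : ℝ → SmoothFn n M} (hf'c : IsSmoothPath f')
    (hf' : IsPathDeriv f f') (s : ℝ) : HasDerivAt (fun r => integ (f r)) (integ (f' s)) s :=
  hf'.hasDerivAt_integral (riemVolume n M) hf'c s

omit [RiemannianBundle (fun x : M => TangentSpace (𝓡 n) x)] [MeasurableSpace M]
  [CompactSpace M] [BorelSpace M] [IsFiniteMeasure (riemVolume n M)] in
theorem IsSmoothPath.line (u h : SmoothFn n M) : IsSmoothPath fun ε : ℝ => u + ε • h :=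
  (IsSmoothPath.const u).add ((IsSmoothPath.const h).smul contDiff_id)

omit [RiemannianBundle (fun x : M => TangentSpace (𝓡 n) x)] [MeasurableSpace M]
  [CompactSpace M] [BorelSpace M] [IsFiniteMeasure (riemVolume n M)] in
theorem IsPathDeriv.line (u h : SmoothFn n M) :
    IsPathDeriv (fun ε : ℝ => u + ε • h) fun _ => h := fun s x => by
  simpa using! ((hasDerivAt_id s).mul_const (h x)).const_add (u x)

variable [IsManifold (𝓡 n) ∞ M] [IsContMDiffRiemannianBundle (𝓡 n) ∞ (EuclideanSpace ℝ (Fin n))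
  (fun x : M => TangentSpace (𝓡 n) x)]

section Pairing

omit [MeasurableSpace M] [CompactSpace M] [BorelSpace M] [IsFiniteMeasure (riemVolume n M)]

theorem gradPair_add_right (f g h : SmoothFn n M) :
    gradPair f (g + h) = gradPair f g + gradPair f h := by
  rw [gradPair_comm, gradPair_add_left, gradPair_comm g, gradPair_comm h]

theorem gradPair_smul_right (c : ℝ) (f h : SmoothFn n M) :
    gradPair f (c • h) = c • gradPair f h := by
  rw [gradPair_comm, gradPair_smul_left, gradPair_comm]

theorem gradPair_sub_left (f g h : SmoothFn n M) :
    gradPair (f - g) h = gradPair f h - gradPair g h := by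
  have := gradPair_add_left (f - g) g h
  rw [sub_add_cancel] at this
  rw [this, add_sub_cancel_right]

theorem gradPair_sub_right (f g h : SmoothFn n M) :
    gradPair f (g - h) = gradPair f g - gradPair f h := by
  rw [gradPair_comm, gradPair_sub_left, gradPair_comm g, gradPair_comm h]

end Pairing

omit [CompactSpace M] [BorelSpace M] [IsFiniteMeasure (riemVolume n M)] in
theorem isTangentOf_iff {ρ Φ V : SmoothFn n M} :
    IsTangentOf ρ Φ V ↔ ∀ ψ, integ (V * ψ) = integ (ρ * gradPair Φ ψ) := Iff.rfl

omit [CompactSpace M] [BorelSpace M] [IsFiniteMeasure (riemVolume n M)] in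
theorem hamiltonian_eq (F : SmoothFn n M → ℝ) (ρ S : SmoothFn n M) :
    hamiltonian F ρ S = 1 / 2 * integ (ρ * gradPair S S)
      - 1 / 2 * integ (ρ * gradPair (firstVariation F ρ) (firstVariation F ρ)) := by
  rw [mul_comm ρ, mul_comm ρ]
  rfl

theorem hasDerivAt_hamiltonian_momentum (F : SmoothFn n M → ℝ) (ρ S h : SmoothFn n M) :
    HasDerivAt (fun ε : ℝ => hamiltonian F ρ (S + ε • h)) (integ (ρ * gradPair S h)) 0 := by
  have hs := IsSmoothPath.line S h
  have hd := IsPathDeriv.line S h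
  have hc := IsSmoothPath.const h
  have h1 := ((IsPathDeriv.const ρ).mul (hd.gradPair hs hs hd)).hasDerivAt_integ
    (((IsSmoothPath.const 0).mul (hs.gradPair hs)).add
      ((IsSmoothPath.const ρ).mul ((hc.gradPair hs).add (hs.gradPair hc)))) 0
  simp only [hamiltonian_eq]
  refine ((h1.const_mul (1 / 2)).sub_const _).congr_deriv ?_
  simp only [zero_smul, add_zero, zero_mul, zero_add, gradPair_comm h S, mul_add, integ_add]
  ring

/-- The last term, with `w = δ²F(ρ)h`, records that `δF(ρ)` moves together with `ρ`. -/
theorem hasDerivAt_hamiltonian_density {F : SmoothFn n M → ℝ} {ρ h w : SmoothFn n M}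
    (hw : IsSecondVariation F ρ h w) (S : SmoothFn n M) :
    HasDerivAt (fun ε : ℝ => hamiltonian F (ρ + ε • h) S)
      (1 / 2 * integ (h * gradPair S S)
        - 1 / 2 * integ (h * gradPair (firstVariation F ρ) (firstVariation F ρ))
        - integ (ρ * gradPair (firstVariation F ρ) w)) 0 := by
  obtain ⟨Q, Q', hQs, hQ's, hQ', rfl, hQ⟩ := hw
  have hQ0 : Q 0 = firstVariation F ρ := by simpa using hQ.self_of_nhds
  have hs := IsSmoothPath.line ρ h
  have hd := IsPathDeriv.line ρ h
  have hc := IsSmoothPath.const h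
  have h1 := (hd.mul (IsPathDeriv.const (gradPair S S))).hasDerivAt_integ
    ((hc.mul (IsSmoothPath.const (gradPair S S))).add (hs.mul (IsSmoothPath.const 0))) 0
  have h2 := (hd.mul (hQ'.gradPair hQs hQs hQ')).hasDerivAt_integ
    ((hc.mul (hQs.gradPair hQs)).add (hs.mul ((hQ's.gradPair hQs).add (hQs.gradPair hQ's)))) 0
  have h3 := (h1.const_mul (1 / 2)).sub (h2.const_mul (1 / 2))
  refine (h3.congr_of_eventuallyEq ?_).congr_deriv ?_
  · filter_upwards [hQ] with ε hε
    rw [hamiltonian_eq, ← hε]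
    rfl
  · simp only [zero_smul, add_zero, mul_zero, hQ0, gradPair_comm (Q' 0), mul_add, integ_add]
    ring

omit [IsManifold (𝓡 n) ∞ M]
  [IsContMDiffRiemannianBundle (𝓡 n) ∞ (EuclideanSpace ℝ (Fin n))
  (fun x : M => TangentSpace (𝓡 n) x)] in
theorem IsSecondVariation.iteratedDeriv_eq {D : Set (SmoothFn n M)} {F : SmoothFn n M → ℝ}
    (hF : IsSmoothFunctional D F) {ρ h w : SmoothFn n M} (hρ : ∀ x, 0 < ρ x)
    (hw : IsSecondVariation F ρ h w) :
    iteratedDeriv 2 (fun ε : ℝ => F (ρ + ε • h)) 0 = integ (w * h) := by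
  obtain ⟨χ, h1, h2, m, hm, h3⟩ := (isPosPath_const hρ).exists_truncation h
  obtain ⟨Q, Q', hQs, hQ's, hQ', rfl, hQ⟩ := hw
  have h4 : deriv (fun ε : ℝ => F (ρ + ε • h)) =ᶠ[𝓝 0] fun ε => integ (Q ε * h) := by
    filter_upwards [hQ, h2] with ε hε hχ
    have : ρ + ε • h ∈ D := hF.pos_mem _ fun x => by
      have := hm.trans_le (h3 0 ε x)
      rwa [hχ] at this
    rw [(hasDerivAt_line hF this).deriv, hε]
    rfl
  have h5 := (hQ'.mul (IsPathDeriv.const h)).hasDerivAt_integ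
    ((hQ's.mul (IsSmoothPath.const h)).add (hQs.mul (IsSmoothPath.const 0))) 0
  rw [iteratedDeriv_succ, iteratedDeriv_one, h4.deriv_eq, h5.deriv]
  simp

omit [IsManifold (𝓡 n) ∞ M]
  [IsContMDiffRiemannianBundle (𝓡 n) ∞ (EuclideanSpace ℝ (Fin n))
  (fun x : M => TangentSpace (𝓡 n) x)] in
/-- The homogeneity relation, differentiated along the density manifold. -/
theorem IsSecondVariation.integ_mul_density {D : Set (SmoothFn n M)} {F : SmoothFn n M → ℝ}
    (hF : IsSmoothFunctional D F) {a b : ℝ} (ha : a ≠ 0) (hhom : IsHomogeneousWith a b F)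
    {ρ V w : SmoothFn n M} (hρ : ρ ∈ densities n M) (hV : integ V = 0)
    (hw : IsSecondVariation F ρ V w) :
    integ (w * ρ) = (a - 1) * integ (firstVariation F ρ * V) := by
  obtain ⟨χ, h1, h2, m, hm, h3⟩ := (isPosPath_const hρ.1).exists_truncation V
  obtain ⟨Q, Q', hQs, hQ's, hQ', rfl, hQ⟩ := hw
  have hQ0 : Q 0 = firstVariation F ρ := by simpa using hQ.self_of_nhds
  have h4 : (fun ε : ℝ => F (ρ + ε • V)) =ᶠ[𝓝 0]
      fun ε => a⁻¹ * integ (Q ε * (ρ + ε • V)) + b := by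
    -- Homogeneity is assumed on probability densities only; the zero mean of `V` keeps `ρ + ε • V`
    -- of mass `1`.
    filter_upwards [hQ, h2] with ε hε hχ
    have hd : ρ + ε • V ∈ densities n M := by
      refine ⟨fun x => ?_, ?_⟩
      · have := hm.trans_le (h3 0 ε x)
        rwa [hχ] at this
      · change integ (ρ + ε • V) = 1
        rw [integ_add, integ_smul, hV, mul_zero, add_zero]
        exact hρ.2
    rw [hhom _ hd, hε]
    rfl
  have hs := IsSmoothPath.line ρ V
  have h5 := (hQ'.mul (IsPathDeriv.line ρ V)).hasDerivAt_integ
    ((hQ's.mul hs).add (hQs.mul (IsSmoothPath.const V))) 0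
  have h6 := ((h5.const_mul a⁻¹).add_const b).congr_of_eventuallyEq h4
  have h7 := h6.unique (hasL2Gradient_firstVariation hF (hF.pos_mem _ hρ.1) V)
  have h8 : a⁻¹ * integ (Q' 0 * (ρ + (0 : ℝ) • V) + Q 0 * V) = integ (firstVariation F ρ * V) := h7
  rw [zero_smul, add_zero, integ_add, hQ0] at h8
  field_simp at h8
  linarith

omit [CompactSpace M] [BorelSpace M] [IsFiniteMeasure (riemVolume n M)] in
-- Test against the constant function `1`.
theorem integ_eq_zero_of_isTangentOf {ρ Φ V : SmoothFn n M} (h : IsTangentOf ρ Φ V) :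
    integ V = 0 := by
  have := isTangentOf_iff.1 h 1
  rw [gradPair_one_right, mul_one, mul_zero] at this
  rw [this]
  simp [integ]

theorem wassersteinHess_eq {D : Set (SmoothFn n M)} {F : SmoothFn n M → ℝ}
    (hF : IsSmoothFunctional D F) {ρ Φ V w : SmoothFn n M} (hρ : ∀ x, 0 < ρ x)
    (hw : IsSecondVariation F ρ V w) : wassersteinHess F ρ Φ V = integ (w * V)
      + integ (ρ * gradPair Φ (gradPair (firstVariation F ρ) Φ))
      - 1 / 2 * integ (ρ * gradPair (firstVariation F ρ) (gradPair Φ Φ)) := by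
  rw [wassersteinHess, hw.iteratedDeriv_eq hF hρ, ← integ_smul, add_sub_assoc, ← integ_sub]
  congr 1
  refine integral_congr_ae (Filter.Eventually.of_forall fun x => ?_)
  simp only [hessGrad, SmoothFn.sub_apply, SmoothFn.mul_apply, SmoothFn.smul_apply, gradPair_apply]
  change (gradInner n Φ (gradPair (firstVariation F ρ) Φ) x - 1 / 2 *
    gradInner n (firstVariation F ρ) (gradPair Φ Φ) x) * ρ x = _
  ring

/-- A smooth curve in the phase space that solves the Hamiltonian flow, with speed `θ`, at the
time `s`; the derivatives `R'`, `S'`, `U'` of `ρ`, `S` and `δF(ρ)` enter weakly. -/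
structure IsFlowAt (F : SmoothFn n M → ℝ) (θ : ℝ) (R S R' S' U' : SmoothFn n M) : Prop where
  speed_pos : 0 < θ
  mem_densities : R ∈ densities n M
  density_eq : ∀ h, integ (R' * h) = θ * integ (R * gradPair S h)
  momentum_eq : ∀ h w, IsSecondVariation F R h w → integ (S' * h) = -θ *
    (1 / 2 * integ (h * gradPair S S)
      - 1 / 2 * integ (h * gradPair (firstVariation F R) (firstVariation F R))
      - integ (R * gradPair (firstVariation F R) w))
  variation_eq : ∀ h w, IsSecondVariation F R h w → integ (U' * h) = integ (w * R')

namespace IsFlowAt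

variable [T2Space M] {D : Set (SmoothFn n M)} {F : SmoothFn n M → ℝ} {θ : ℝ}
  {R S R' S' U' : SmoothFn n M}

/-- Hamilton's cancellation in weak form. The field `Z = -div(R∇u)` rewrites `∫ R (∇u, ∇·)` as a
pairing, and symmetry of `δ²F` in the directions `Z` and `R'` cancels the remaining terms. -/
theorem hamiltonian_deriv (h : IsFlowAt F θ R S R' S' U') (hF : IsSmoothFunctional D F) :
    1 / 2 * integ (R' * gradPair S S) + integ (R * gradPair S S')
      - (1 / 2 * integ (R' * gradPair (firstVariation F R) (firstVariation F R))
        + integ (R * gradPair (firstVariation F R) U')) = 0 := by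
  obtain ⟨Z, hZ⟩ := exists_isTangentOf R (firstVariation F R)
  rw [isTangentOf_iff] at hZ
  obtain ⟨z, hz⟩ := exists_isSecondVariation hF h.mem_densities.1 Z
  obtain ⟨r, hr⟩ := exists_isSecondVariation hF h.mem_densities.1 R'
  have e1 := h.density_eq S'
  have e2 := h.momentum_eq R' r hr
  have e3 := h.variation_eq Z z hz
  have e4 : integ (r * Z) = integ (z * R') := hz.symm hF h.mem_densities.1 hr
  rw [mul_comm U'] at e3
  rw [mul_comm r] at e4
  rw [mul_comm S'] at e2
  rw [← hZ] at e2 ⊢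
  have := h.speed_pos.ne'
  refine mul_left_cancel₀ this ?_
  linear_combination -e1 + e2 - θ * e3 + θ * e4

theorem integ_momentum_density (h : IsFlowAt F θ R S R' S' U') (hF : IsSmoothFunctional D F)
    {a b : ℝ} (ha : a ≠ 0) (hhom : IsHomogeneousWith a b F) :
    integ (R * S') = -θ * (1 / 2 * integ (R * gradPair S S)
      - (a - 1 / 2) * integ (R * gradPair (firstVariation F R) (firstVariation F R))) := by
  obtain ⟨Z, hZ⟩ := exists_isTangentOf R (firstVariation F R)
  obtain ⟨z, hz⟩ := exists_isSecondVariation hF h.mem_densities.1 Z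
  obtain ⟨r, hr⟩ := exists_isSecondVariation hF h.mem_densities.1 R
  -- Homogeneity cannot be differentiated in the direction `R`, which has mass `1`. Symmetry moves
  -- the second variation to `Z`, which has mean zero.
  have e1 := hz.integ_mul_density hF ha hhom h.mem_densities (integ_eq_zero_of_isTangentOf hZ)
  rw [isTangentOf_iff] at hZ
  have e2 := h.momentum_eq R r hr
  have e3 : integ (r * Z) = integ (z * R) := hz.symm hF h.mem_densities.1 hr
  have e4 := hZ (firstVariation F R)
  have e5 := hZ r
  rw [mul_comm S'] at e2
  rw [mul_comm r] at e3
  rw [mul_comm _ Z] at e1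
  linear_combination e2 - θ * e5 + θ * e3 + θ * e1 + θ * (a - 1) * e4

/-- The kinetic, potential and cross terms in `S` and `u` combine into the square of `∇(S + σ u)`:
the coefficient `(1 - a⁻¹) / 2` of the Hamiltonian removes all dependence on `a`. -/
theorem split_deriv (h : IsFlowAt F θ R S R' S' U') (hF : IsSmoothFunctional D F)
    {a b : ℝ} (ha : a ≠ 0) (hhom : IsHomogeneousWith a b F) {σ : ℝ} (hσ : σ * σ = 1) :
    1 / 2 * integ (firstVariation F R * R')
      + σ * (a⁻¹ / 2) * (integ (R' * S) + integ (R * S'))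
      + σ * ((1 - a⁻¹) / 2) * θ * hamiltonian F R S
    = θ * (σ / 4 * integ (R * gradPair (S + σ • firstVariation F R)
        (S + σ • firstVariation F R))) := by
  have e1 := h.density_eq (firstVariation F R)
  have e2 := h.density_eq S
  have e3 := h.integ_momentum_density hF ha hhom
  have e4 : R * gradPair (S + σ • firstVariation F R) (S + σ • firstVariation F R)
      = R * gradPair S S + (2 * σ) • (R * gradPair S (firstVariation F R))
        + (σ * σ) • (R * gradPair (firstVariation F R) (firstVariation F R)) := by
    ext x
    simp only [gradPair_add_left, gradPair_add_right, gradPair_smul_left, gradPair_smul_right,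
      gradPair_comm _ S, SmoothFn.add_apply, SmoothFn.mul_apply, SmoothFn.smul_apply]
    ring
  rw [mul_comm _ R', e1, e2, e3, hamiltonian_eq, e4, integ_add, integ_add, integ_smul, integ_smul]
  field_simp
  ring_nf
  have : σ ^ 2 = 1 := by rw [sq, hσ]
  have h3 : σ ^ 3 = σ := by rw [pow_succ, this, one_mul]
  simp only [this, h3]
  ring

/-- The right side equals `θ / 2` times the Wasserstein Hessian in the direction `-div(R∇φ)`, so
this is half of the convexity inequality, scaled by the speed. -/
theorem dissipation_deriv (h : IsFlowAt F θ R S R' S' U') (hF : IsSmoothFunctional D F)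
    {lam : ℝ} (hconv : IsWassersteinConvex lam F) {σ : ℝ} (hσ : σ * σ = 1) :
    θ * (2 * lam * σ * (σ / 4 * integ (R * gradPair (S + σ • firstVariation F R)
        (S + σ • firstVariation F R)))) ≤
      σ / 4 * (integ (R' * gradPair (S + σ • firstVariation F R) (S + σ • firstVariation F R))
        + 2 * integ (R * gradPair (S + σ • firstVariation F R) (S' + σ • U'))) := by
  set u := firstVariation F R with hu
  set φ := S + σ • u with hφ
  obtain ⟨Z, hZ⟩ := exists_isTangentOf R u
  rw [isTangentOf_iff] at hZ
  -- `R'` corresponds to `θ S` and `Z` to `u`, so `V` is the tangent vector of `φ = S + σ u`.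
  set V := θ⁻¹ • R' + σ • Z with hV
  have hθ := h.speed_pos.ne'
  have hVt : ∀ ψ, integ (V * ψ) = integ (R * gradPair φ ψ) := by
    intro ψ
    have e1 := h.density_eq ψ
    rw [hV, hφ, gradPair_add_left, gradPair_smul_left, add_mul, mul_add, smul_mul_assoc,
      smul_mul_assoc, mul_smul_comm, integ_add, integ_add, integ_smul, integ_smul, integ_smul,
      hZ, e1]
    field_simp
  obtain ⟨w, hw⟩ := exists_isSecondVariation hF h.mem_densities.1 V
  have hc := hconv R h.mem_densities φ V (isTangentOf_iff.2 hVt)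
  rw [wassersteinHess_eq hF h.mem_densities.1 hw] at hc
  have hc' : lam * integ (V * φ) ≤ _ := hc
  rw [hVt, ← hu] at hc'
  have e1 := h.density_eq (gradPair φ φ)
  have e2 := h.momentum_eq V w hw
  have e3 := h.variation_eq V w hw
  have e4 := hZ w
  have e5 : integ (R * gradPair φ (S' + σ • U')) = integ (S' * V) + σ * integ (U' * V) := by
    rw [← hVt, mul_add, mul_smul_comm, integ_add, integ_smul, mul_comm V, mul_comm V]
  have e6 : integ (w * V) = θ⁻¹ * integ (w * R') + σ * integ (Z * w) := by
    rw [hV, mul_add, mul_smul_comm, mul_smul_comm, integ_add, integ_smul, integ_smul, mul_comm w Z]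
  rw [← hu, hVt, hVt, ← e4] at e2
  -- Eliminating `S` leaves the cubic terms in `φ` to cancel, while the mixed ones form the
  -- integrated `∇²u (∇φ, ∇φ)`.
  have hS : S = φ - σ • u := by rw [hφ, add_sub_cancel_right]
  have e7 : integ (R * gradPair S (gradPair φ φ)) =
      integ (R * gradPair φ (gradPair φ φ)) - σ * integ (R * gradPair u (gradPair φ φ)) := by
    rw [hS, gradPair_sub_left, gradPair_smul_left, mul_sub, mul_smul_comm, integ_sub, integ_smul]
  have e8 : integ (R * gradPair φ (gradPair S S)) =
      integ (R * gradPair φ (gradPair φ φ)) - 2 * σ * integ (R * gradPair φ (gradPair u φ))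
        + integ (R * gradPair φ (gradPair u u)) := by
    have e9 : gradPair S S = gradPair φ φ - (2 * σ) • gradPair u φ + gradPair u u := by
      ext x
      rw [hS]
      simp only [gradPair_sub_left, gradPair_sub_right, gradPair_smul_left, gradPair_smul_right,
        gradPair_comm φ u, SmoothFn.sub_apply, SmoothFn.add_apply, SmoothFn.smul_apply]
      linear_combination gradPair u u x * hσ
    rw [e9, gradPair_add_right, gradPair_sub_right, gradPair_smul_right, mul_add, mul_sub,
      mul_smul_comm, integ_add, integ_sub, integ_smul]
  rw [e1, e5, e2, e3, e7, e8]
  have e10 : integ (w * R') = θ * integ (w * V) - θ * σ * integ (Z * w) := by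
    rw [e6]
    field_simp
    ring
  rw [e10]
  have h5 := mul_le_mul_of_nonneg_left hc' h.speed_pos.le
  linear_combination (1 / 2) * h5 + θ * (lam / 2 * integ (R * gradPair φ φ) - integ (w * V) / 2
    - integ (R * gradPair φ (gradPair u φ)) / 2 + integ (R * gradPair u (gradPair φ φ)) / 4
    + σ / 2 * integ (Z * w)) * hσ

end IsFlowAt

end

section
/-! ### Convexity with respect to an exponential time change -/

/-- The primitive of `exp (κ t)` that vanishes at `0`. -/
def expPrimitive (κ t : ℝ) : ℝ := if κ = 0 then t else (Real.exp (κ * t) - 1) / κ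

theorem hasDerivAt_expPrimitive (κ t : ℝ) :
    HasDerivAt (expPrimitive κ) (Real.exp (κ * t)) t := by
  by_cases hκ : κ = 0
  · have : expPrimitive κ = id := by ext; simp [expPrimitive, hκ]
    rw [this]
    simpa [hκ] using hasDerivAt_id t
  · have h : HasDerivAt (fun r => (Real.exp (κ * r) - 1) / κ) (Real.exp (κ * t)) t := by
      have := ((((hasDerivAt_id t).const_mul κ).exp).sub_const 1).div_const κ
      refine this.congr_deriv ?_
      simp only [id]
      field_simp
    have h2 : expPrimitive κ = fun r => (Real.exp (κ * r) - 1) / κ := by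
      ext
      simp [expPrimitive, hκ]
    rwa [h2]

@[simp] theorem expPrimitive_zero (κ : ℝ) : expPrimitive κ 0 = 0 := by simp [expPrimitive]

theorem strictMono_expPrimitive (κ : ℝ) : StrictMono (expPrimitive κ) :=
  strictMono_of_deriv_pos fun t => by
    rw [(hasDerivAt_expPrimitive κ t).deriv]
    exact Real.exp_pos _

theorem alpha_eq_div (lam t : ℝ) :
    alpha lam t = expPrimitive (-2 * lam) t / expPrimitive (-2 * lam) 1 := by
  by_cases h : lam = 0
  · simp [alpha, expPrimitive, h]
  · have h1 : Real.exp (-2 * lam) ≠ 1 := by simp [h]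
    have h2 : Real.exp (-2 * lam) - 1 ≠ 0 := sub_ne_zero.2 h1
    have h3 : 1 - Real.exp (-2 * lam) ≠ 0 := sub_ne_zero.2 h1.symm
    have h4 : -2 * lam ≠ 0 := by simp [h]
    simp only [alpha, expPrimitive, h, h4, if_false, mul_one]
    rw [div_div_div_cancel_right₀ h4, ← neg_sub (Real.exp _) 1, ← neg_sub (Real.exp _) 1,
      neg_div_neg_eq]

/-- Multiplying numerator and denominator by `e^(2 lam)` reverses time and changes the sign of the
rate. -/
theorem alpha_one_sub_eq_div (lam t : ℝ) :
    1 - alpha lam (1 - t) = expPrimitive (2 * lam) t / expPrimitive (2 * lam) 1 := by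
  by_cases h : lam = 0
  · simp [alpha, expPrimitive, h]
  · have h1 : Real.exp (2 * lam) ≠ 1 := by simp [h]
    have h2 : Real.exp (2 * lam) - 1 ≠ 0 := sub_ne_zero.2 h1
    have h4 : 2 * lam ≠ 0 := by simp [h]
    have e0 := Real.exp_pos (2 * lam)
    have e1 : Real.exp (-2 * lam) = (Real.exp (2 * lam))⁻¹ := by rw [← Real.exp_neg]; ring_nf
    have e2 : Real.exp (-2 * lam * (1 - t)) = (Real.exp (2 * lam))⁻¹ * Real.exp (2 * lam * t) := by
      rw [← Real.exp_neg, ← Real.exp_add]; ring_nf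
    simp only [alpha, expPrimitive, h, h4, if_false, mul_one]
    rw [div_div_div_cancel_right₀ h4, e1, e2]
    have h3 : 1 - (Real.exp (2 * lam))⁻¹ = (Real.exp (2 * lam) - 1) / Real.exp (2 * lam) := by
      field_simp
    rw [h3]
    field_simp
    ring

/-- A function `y` with `y' = k' P` and `P' ≥ κ k' P` is convex as a function of
`expPrimitive κ ∘ k`. -/
theorem le_of_expPrimitive_convex {κ l r : ℝ} {k θ y y' P P' : ℝ → ℝ}
    (hk : ∀ s, HasDerivAt k (θ s) s) (hθ : ∀ s ∈ Ioo l r, 0 < θ s)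
    (hy : ∀ s, HasDerivAt y (y' s) s) (hP : ∀ s, HasDerivAt P (P' s) s)
    (hyP : ∀ s ∈ Ioo l r, y' s = θ s * P s)
    (hPκ : ∀ s ∈ Ioo l r, κ * θ s * P s ≤ P' s) {s : ℝ} (hs : s ∈ Icc l r) :
    (expPrimitive κ (k r) - expPrimitive κ (k l)) * y s ≤
      (expPrimitive κ (k r) - expPrimitive κ (k s)) * y l
        + (expPrimitive κ (k s) - expPrimitive κ (k l)) * y r := by
  rcases hs.1.eq_or_lt with rfl | hl
  · simp
  rcases hs.2.eq_or_lt with rfl | hr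
  · simp
  have hτ : ∀ u, HasDerivAt (fun u => expPrimitive κ (k u)) (Real.exp (κ * k u) * θ u) u :=
    fun u => (hasDerivAt_expPrimitive κ (k u)).comp u (hk u)
  have hτc : Continuous fun u => expPrimitive κ (k u) :=
    continuous_iff_continuousAt.2 fun u => (hτ u).continuousAt
  have hyc : Continuous y := continuous_iff_continuousAt.2 fun u => (hy u).continuousAt
  have hkm : StrictMonoOn k (Icc l r) :=
    strictMonoOn_of_deriv_pos (convex_Icc l r)
      (continuous_iff_continuousAt.2 fun u => (hk u).continuousAt).continuousOn fun u hu => by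
        rw [interior_Icc] at hu
        rw [(hk u).deriv]
        exact hθ u hu
  have hm : ∀ u, HasDerivAt (fun u => Real.exp (-(κ * k u)) * P u)
      (Real.exp (-(κ * k u)) * (P' u - κ * θ u * P u)) u := fun u => by
    refine ((((hk u).const_mul κ).neg.exp).mul (hP u)).congr_deriv ?_
    simp only [Pi.neg_apply]
    ring
  have hmm : MonotoneOn (fun u => Real.exp (-(κ * k u)) * P u) (Icc l r) :=
    -- The hypothesis on `P'` says that `e^(-κ k) P`, the derivative of `y` with respect to
    -- `expPrimitive κ ∘ k`, is nondecreasing.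
    monotoneOn_of_deriv_nonneg (convex_Icc l r)
      (continuous_iff_continuousAt.2 fun u => (hm u).continuousAt).continuousOn
      (fun u _ => (hm u).differentiableAt.differentiableWithinAt) fun u hu => by
        rw [interior_Icc] at hu
        rw [(hm u).deriv]
        exact mul_nonneg (Real.exp_pos _).le (sub_nonneg.2 (hPκ u hu))
  have key : ∀ p q, p < q → l ≤ p → q ≤ r → ∃ c ∈ Ioo p q, y q - y p =
      (expPrimitive κ (k q) - expPrimitive κ (k p)) * (Real.exp (-(κ * k c)) * P c) := by
    intro p q hpq hlp hqr
    -- Cauchy's mean value theorem gives slopes with respect to the new variable without inverting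
    -- the time change.
    obtain ⟨c, hc, h⟩ := exists_ratio_hasDerivAt_eq_ratio_slope y y' hpq hyc.continuousOn
      (fun u _ => hy u) _ _ hτc.continuousOn (fun u _ => hτ u)
    have hc' : c ∈ Ioo l r := ⟨hlp.trans_lt hc.1, hc.2.trans_le hqr⟩
    refine ⟨c, hc, ?_⟩
    rw [hyP c hc'] at h
    have h0 := hθ c hc'
    refine mul_right_cancel₀ (mul_pos (Real.exp_pos (κ * k c)) h0).ne' ?_
    have he : Real.exp (-(κ * k c)) * Real.exp (κ * k c) = 1 := by
      rw [← Real.exp_add]; simp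
    linear_combination -h - (expPrimitive κ (k q) - expPrimitive κ (k p)) * P c * θ c * he
  obtain ⟨c₁, hc₁, h₁⟩ := key l s hl le_rfl hs.2
  obtain ⟨c₂, hc₂, h₂⟩ := key s r hr hs.1 le_rfl
  have hle := hmm ⟨hc₁.1.le, (hc₁.2.trans hr).le⟩ ⟨(hl.trans hc₂.1).le, hc₂.2.le⟩
    (hc₁.2.trans hc₂.1).le
  have t1 := sub_pos.2 (strictMono_expPrimitive κ
    (hkm (left_mem_Icc.2 (hl.trans hr).le) hs hl))
  have t2 := sub_pos.2 (strictMono_expPrimitive κ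
    (hkm hs (right_mem_Icc.2 (hl.trans hr).le) hr))
  have h3 := mul_le_mul_of_nonneg_left hle (mul_pos t1 t2).le
  simp only at h3
  linear_combination h3 + (expPrimitive κ (k r) - expPrimitive κ (k s)) * h₁
    - (expPrimitive κ (k s) - expPrimitive κ (k l)) * h₂

end

section
/-! ### Passing to a curve defined on the whole line -/

theorem sin_sq_mem_Icc (s : ℝ) : Real.sin s ^ 2 ∈ Icc (0 : ℝ) 1 :=
  ⟨sq_nonneg _, Real.sin_sq_le_one s⟩

theorem sin_sq_mem_Ioo {s : ℝ} (hs : s ∈ Ioo 0 (Real.pi / 2)) : Real.sin s ^ 2 ∈ Ioo (0 : ℝ) 1 := by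
  have h1 := Real.sin_pos_of_pos_of_lt_pi hs.1 (by linarith [hs.2, Real.pi_pos])
  have h2 := Real.cos_pos_of_mem_Ioo ⟨by linarith [hs.1, Real.pi_pos], hs.2⟩
  exact ⟨by positivity, by nlinarith [Real.sin_sq_add_cos_sq s]⟩

theorem sin_sq_speed_pos {s : ℝ} (hs : s ∈ Ioo 0 (Real.pi / 2)) :
    0 < 2 * Real.sin s * Real.cos s := by
  have h1 := Real.sin_pos_of_pos_of_lt_pi hs.1 (by linarith [hs.2, Real.pi_pos])
  have h2 := Real.cos_pos_of_mem_Ioo ⟨by linarith [hs.1, Real.pi_pos], hs.2⟩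
  positivity

theorem hasDerivAt_sin_sq (s : ℝ) :
    HasDerivAt (fun s => Real.sin s ^ 2) (2 * Real.sin s * Real.cos s) s := by
  exact ((Real.hasDerivAt_sin s).pow 2).congr_deriv (by simp)

theorem exists_sin_sq_eq {t : ℝ} (ht : t ∈ Icc (0 : ℝ) 1) :
    ∃ s ∈ Icc 0 (Real.pi / 2), Real.sin s ^ 2 = t := by
  refine ⟨Real.arcsin (Real.sqrt t), ⟨Real.arcsin_nonneg.2 (Real.sqrt_nonneg t),
    Real.arcsin_le_pi_div_two _⟩, ?_⟩
  rw [Real.sin_arcsin (by linarith [Real.sqrt_nonneg t]) (Real.sqrt_le_one.2 ht.2),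
    Real.sq_sqrt ht.1]

variable {n : ℕ} {M : Type*} [TopologicalSpace M] [ChartedSpace (EuclideanSpace ℝ (Fin n)) M]

section Path

variable {f : ℝ → SmoothFn n M} (hf : ContMDiffOn (𝓘(ℝ, ℝ).prod (𝓡 n)) 𝓘(ℝ, ℝ) ∞
  (fun p : ℝ × M => f p.1 p.2) (Icc 0 1 ×ˢ univ))
include hf

/-- Since `sin²` maps the line into `[0, 1]`, smoothness on the closed interval becomes smoothness
everywhere, with no extension of the flow. -/
theorem isSmoothPath_comp_sin_sq : IsSmoothPath fun s => f (Real.sin s ^ 2) := by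
  rw [IsSmoothPath, ← contMDiffOn_univ]
  refine hf.comp (f := fun p : ℝ × M => (Real.sin p.1 ^ 2, p.2)) (ContMDiff.contMDiffOn ?_)
    fun p _ => ⟨sin_sq_mem_Icc p.1, mem_univ _⟩
  exact ((Real.contDiff_sin.pow 2).contMDiff.comp contMDiff_fst).prodMk contMDiff_snd

theorem IsPathDeriv.eq_speed_mul_deriv {f' : ℝ → SmoothFn n M}
    (hf' : IsPathDeriv (fun s => f (Real.sin s ^ 2)) f') {s : ℝ} (hs : s ∈ Ioo 0 (Real.pi / 2))
    (x : M) : f' s x = 2 * Real.sin s * Real.cos s * deriv (fun r => f r x) (Real.sin s ^ 2) := by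
  have ht := sin_sq_mem_Ioo hs
  have h1 : ContMDiffOn 𝓘(ℝ, ℝ) 𝓘(ℝ, ℝ) ∞ (fun r : ℝ => f r x) (Icc 0 1) :=
    hf.comp (f := fun r : ℝ => (r, x)) (contMDiff_id.prodMk contMDiff_const).contMDiffOn
      fun r hr => ⟨hr, mem_univ _⟩
  have h2 : DifferentiableAt ℝ (fun r : ℝ => f r x) (Real.sin s ^ 2) :=
    ((contMDiffOn_iff_contDiffOn.1 h1).differentiableOn (by simp)).differentiableAt
      (Icc_mem_nhds ht.1 ht.2)
  have h3 := h2.hasDerivAt.comp s (hasDerivAt_sin_sq s)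
  rw [mul_comm]
  exact (hf' s x).unique h3

theorem isPosPath_comp_sin_sq [CompactSpace M] (hpos : ∀ t ∈ Icc (0 : ℝ) 1, ∀ x, 0 < f t x) :
    IsPosPath fun s => f (Real.sin s ^ 2) := by
  refine ⟨isSmoothPath_comp_sin_sq hf, ?_⟩
  rcases isEmpty_or_nonempty M with h | h
  · exact ⟨1, one_pos, fun _ x => isEmptyElim x⟩
  · obtain ⟨p, hp, hmin⟩ := ((isCompact_Icc (a := (0 : ℝ)) (b := 1)).prod
      (isCompact_univ (X := M))).exists_isMinOn
      ((nonempty_Icc.2 zero_le_one).prod univ_nonempty) hf.continuousOn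
    exact ⟨f p.1 p.2, hpos _ hp.1 _, fun s x =>
      hmin (show (Real.sin s ^ 2, x) ∈ _ from ⟨sin_sq_mem_Icc s, mem_univ _⟩)⟩

end Path

variable [RiemannianBundle (fun x : M => TangentSpace (𝓡 n) x)] [MeasurableSpace M]
  [CompactSpace M] [BorelSpace M] [IsFiniteMeasure (riemVolume n M)]
  [IsManifold (𝓡 n) ∞ M] [IsContMDiffRiemannianBundle (𝓡 n) ∞ (EuclideanSpace ℝ (Fin n))
  (fun x : M => TangentSpace (𝓡 n) x)]

/-- The energy `½ F(ρ) + σ (2a)⁻¹ ∫ ρ S`, which for `σ = ± 1` is one of the split energies. -/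
def signedEnergy (F : SmoothFn n M → ℝ) (a σ : ℝ) (ρ S : SmoothFn n M) : ℝ :=
  1 / 2 * F ρ + σ * (a⁻¹ / 2) * integ (ρ * S)

namespace IsHamiltonianFlow

variable {D : Set (SmoothFn n M)} {F : SmoothFn n M → ℝ} {ρ S : ℝ → SmoothFn n M}

/-- Uniqueness of derivatives identifies the gradients in Hamilton's equations with the explicit
variations of the Hamiltonian; the chain rule contributes the speed. -/
theorem isFlowAt (h : IsHamiltonianFlow F ρ S) (hF : IsSmoothFunctional D F)
    {R' S' U' : ℝ → SmoothFn n M} (hR' : IsPathDeriv (fun s => ρ (Real.sin s ^ 2)) R')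
    (hS' : IsPathDeriv (fun s => S (Real.sin s ^ 2)) S')
    (hU' : IsPathDeriv (fun s => firstVariation F (ρ (Real.sin s ^ 2))) U')
    {s : ℝ} (hs : s ∈ Ioo 0 (Real.pi / 2)) :
    IsFlowAt F (2 * Real.sin s * Real.cos s) (ρ (Real.sin s ^ 2)) (S (Real.sin s ^ 2))
      (R' s) (S' s) (U' s) where
  speed_pos := sin_sq_speed_pos hs
  mem_densities := h.mem_densities _ (sin_sq_mem_Icc s)
  density_eq k := by
    rw [← (h.density_eq _ (sin_sq_mem_Ioo hs) k).unique (hasDerivAt_hamiltonian_momentum F _ _ k),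
      ← integral_const_mul]
    refine integral_congr_ae (Filter.Eventually.of_forall fun x => ?_)
    simp only [SmoothFn.mul_apply, hR'.eq_speed_mul_deriv h.smooth_density hs x, mul_assoc]
  momentum_eq k w hw := by
    rw [← (h.momentum_eq _ (sin_sq_mem_Ioo hs) k).unique (hasDerivAt_hamiltonian_density hw _),
      ← integral_const_mul]
    refine integral_congr_ae (Filter.Eventually.of_forall fun x => ?_)
    simp only [SmoothFn.mul_apply, hS'.eq_speed_mul_deriv h.smooth_momentum hs x]
    ring
  variation_eq k w hw := hw.integral_eq hF (isPosPath_comp_sin_sq h.smooth_density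
    fun t ht => (h.mem_densities t ht).1) hR' hU'

variable [T2Space M]

theorem exists_hamiltonian_eq (h : IsHamiltonianFlow F ρ S) (hF : IsSmoothFunctional D F) :
    ∃ Ham : ℝ, ∀ t ∈ Icc (0 : ℝ) 1, hamiltonian F (ρ t) (S t) = Ham := by
  have hpos := isPosPath_comp_sin_sq h.smooth_density fun t ht => (h.mem_densities t ht).1
  have hR := hpos.smooth
  have hS := isSmoothPath_comp_sin_sq h.smooth_momentum
  have hU := isSmoothPath_firstVariation hF hR fun s => hF.pos_mem _ (hpos.pos s)
  obtain ⟨R', hR's, hR'⟩ := hR.exists_pathDeriv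
  obtain ⟨S', hS's, hS'⟩ := hS.exists_pathDeriv
  obtain ⟨U', hU's, hU'⟩ := hU.exists_pathDeriv
  have kin : ∀ {f f' : ℝ → SmoothFn n M}, IsSmoothPath f → IsSmoothPath f' → IsPathDeriv f f' →
      ∀ s, HasDerivAt (fun s => integ (ρ (Real.sin s ^ 2) * gradPair (f s) (f s)))
        (integ (R' s * gradPair (f s) (f s))
          + 2 * integ (ρ (Real.sin s ^ 2) * gradPair (f s) (f' s))) s := by
    intro f f' hf hf's hf' s
    refine ((hR'.mul (hf'.gradPair hf hf hf')).hasDerivAt_integ ((hR's.mul (hf.gradPair hf)).add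
      (hR.mul ((hf's.gradPair hf).add (hf.gradPair hf's)))) s).congr_deriv ?_
    rw [gradPair_comm (f' s), mul_add, integ_add, integ_add]
    ring
  have hd : ∀ s, HasDerivAt
      (fun s => hamiltonian F (ρ (Real.sin s ^ 2)) (S (Real.sin s ^ 2))) _ s := fun s => by
    simp only [hamiltonian_eq]
    exact ((kin hS hS's hS' s).const_mul (1 / 2)).sub ((kin hU hU's hU' s).const_mul (1 / 2))
  refine ⟨hamiltonian F (ρ (Real.sin 0 ^ 2)) (S (Real.sin 0 ^ 2)), fun t ht => ?_⟩
  obtain ⟨s, hs, rfl⟩ := exists_sin_sq_eq ht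
  rcases hs.1.eq_or_lt with rfl | h0
  · rfl
  -- The equations hold only at interior times; the mean value theorem reaches the endpoints by
  -- continuity.
  obtain ⟨r, hr, hslope⟩ := exists_hasDerivAt_eq_slope _ _ h0
    (continuous_iff_continuousAt.2 fun s => (hd s).continuousAt).continuousOn fun r _ => hd r
  have hflow := h.isFlowAt hF hR' hS' hU' (s := r) ⟨hr.1, hr.2.trans_le hs.2⟩
  replace hslope := hslope.symm.trans (Eq.trans (by ring) (hflow.hamiltonian_deriv hF))
  rw [div_eq_zero_iff] at hslope
  exact sub_eq_zero.1 (hslope.resolve_right (by linarith))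

/-- Convexity under the time change, with rate `2 * lam * σ`. Conservation of the Hamiltonian makes
the correction linear in `t`, so that its derivative matches `split_deriv`. -/
theorem signedEnergy_convex (h : IsHamiltonianFlow F ρ S) (hF : IsSmoothFunctional D F)
    {a b lam σ Ham : ℝ} (ha : a ≠ 0) (hhom : IsHomogeneousWith a b F)
    (hconv : IsWassersteinConvex lam F) (hσ : σ * σ = 1)
    (hHam : ∀ t ∈ Icc (0 : ℝ) 1, hamiltonian F (ρ t) (S t) = Ham) {t : ℝ}
    (ht : t ∈ Icc (0 : ℝ) 1) :
    expPrimitive (2 * lam * σ) 1 *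
        (signedEnergy F a σ (ρ t) (S t) + σ * ((1 - a⁻¹) / 2) * t * Ham) ≤
      (expPrimitive (2 * lam * σ) 1 - expPrimitive (2 * lam * σ) t)
          * signedEnergy F a σ (ρ 0) (S 0)
        + expPrimitive (2 * lam * σ) t
          * (signedEnergy F a σ (ρ 1) (S 1) + σ * ((1 - a⁻¹) / 2) * Ham) := by
  have hpos := isPosPath_comp_sin_sq h.smooth_density fun t ht => (h.mem_densities t ht).1
  have hR := hpos.smooth
  have hS := isSmoothPath_comp_sin_sq h.smooth_momentum
  have hU := isSmoothPath_firstVariation hF hR fun s => hF.pos_mem _ (hpos.pos s)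
  obtain ⟨R', hR's, hR'⟩ := hR.exists_pathDeriv
  obtain ⟨S', hS's, hS'⟩ := hS.exists_pathDeriv
  obtain ⟨U', hU's, hU'⟩ := hU.exists_pathDeriv
  have hφ := hS.add (hU.smul (contDiff_const (c := σ)))
  have hφ's := hS's.add (hU's.smul (contDiff_const (c := σ)))
  have hφ' := hS'.add (hU'.smul σ)
  have hP : ∀ s, HasDerivAt _ _ s := fun s =>
    ((hR'.mul (hφ'.gradPair hφ hφ hφ')).hasDerivAt_integ ((hR's.mul (hφ.gradPair hφ)).add
      (hR.mul ((hφ's.gradPair hφ).add (hφ.gradPair hφ's)))) s).const_mul (σ / 4)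
  have hy : ∀ s, HasDerivAt (fun s => signedEnergy F a σ (ρ (Real.sin s ^ 2)) (S (Real.sin s ^ 2))
      + σ * ((1 - a⁻¹) / 2) * Real.sin s ^ 2 * Ham) _ s := fun s =>
    (((hasDerivAt_functional_path hF hpos hR' s).const_mul (1 / 2)).add
      (((hR'.mul hS').hasDerivAt_integ ((hR's.mul hS).add (hR.mul hS's)) s).const_mul
        (σ * (a⁻¹ / 2)))).add
      (((hasDerivAt_sin_sq s).const_mul (σ * ((1 - a⁻¹) / 2))).mul_const Ham)
  obtain ⟨s, hs, rfl⟩ := exists_sin_sq_eq ht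
  have key := le_of_expPrimitive_convex (κ := 2 * lam * σ) (l := 0) (r := Real.pi / 2)
    hasDerivAt_sin_sq (fun s hs => sin_sq_speed_pos hs) hy hP ?_ ?_ hs
  · simpa using key
  · intro s hs
    have := (h.isFlowAt hF hR' hS' hU' hs).split_deriv hF ha hhom hσ
    rw [hHam _ (sin_sq_mem_Icc s)] at this
    rw [← this, integ_add]
    change 1 / 2 * integ (_ * _) + _ + _ = _
    ring
  · intro s hs
    have := (h.isFlowAt hF hR' hS' hU' hs).dissipation_deriv hF hconv hσ
    rw [gradPair_comm (S' s + σ • U' s), mul_add, integ_add, integ_add]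
    linarith

end IsHamiltonianFlow

end

/-! ### Hopf–Cole variables and the split energies -/

section
variable {n : ℕ} {M : Type*} [TopologicalSpace M] [ChartedSpace (EuclideanSpace ℝ (Fin n)) M]
  [RiemannianBundle (fun x : M => TangentSpace (𝓡 n) x)] [MeasurableSpace M]
  {D : Set (SmoothFn n M)} {F : SmoothFn n M → ℝ} {η ηs ρ S : SmoothFn n M}

/-- Injectivity on `D` forces the chosen preimage of `δF(η) + δF(η*)` to be `ρ`. -/
theorem IsHopfCole.hopfColeDensity_eq (h : IsHopfCole F η ηs ρ S)
    (hinv : InjOn (firstVariation F) D) (hρ : ρ ∈ D) : hopfColeDensity D F η ηs = ρ := by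
  rw [hopfColeDensity, ← h.1]
  exact hinv.leftInvOn_invFunOn hρ

variable [CompactSpace M] [BorelSpace M] [IsFiniteMeasure (riemVolume n M)]

/-- From `δF(η) = ½ (δF(ρ) + S)`; homogeneity turns the first half into half of the energy. -/
theorem IsHopfCole.splitG_eq (h : IsHopfCole F η ηs ρ S) (hinv : InjOn (firstVariation F) D)
    (hρ : ρ ∈ D) (hρ' : ρ ∈ densities n M) {a b : ℝ} (hhom : IsHomogeneousWith a b F) :
    splitG D F a b η ηs = signedEnergy F a 1 ρ S := by
  have h1 : F ρ = a⁻¹ * integ (firstVariation F ρ * ρ) + b := hhom ρ hρ'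
  have h2 : integ (ρ * firstVariation F η) =
      1 / 2 * (integ (firstVariation F ρ * ρ) + integ (ρ * S)) := by
    rw [← integ_add, ← integ_smul, h.1, h.2]
    congr 1
    ext x
    simp only [SmoothFn.add_apply, SmoothFn.sub_apply, SmoothFn.mul_apply, SmoothFn.smul_apply]
    ring
  rw [splitG, h.hopfColeDensity_eq hinv hρ, signedEnergy, h1]
  change a⁻¹ * integ (ρ * firstVariation F η) + b / 2 = _
  rw [h2]
  ring

theorem IsHopfCole.splitGstar_eq (h : IsHopfCole F η ηs ρ S) (hinv : InjOn (firstVariation F) D)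
    (hρ : ρ ∈ D) (hρ' : ρ ∈ densities n M) {a b : ℝ} (hhom : IsHomogeneousWith a b F) :
    splitGstar D F a b η ηs = signedEnergy F a (-1) ρ S := by
  have h1 : F ρ = a⁻¹ * integ (firstVariation F ρ * ρ) + b := hhom ρ hρ'
  have h2 : integ (ρ * firstVariation F ηs) =
      1 / 2 * (integ (firstVariation F ρ * ρ) - integ (ρ * S)) := by
    rw [← integ_sub, ← integ_smul, h.1, h.2]
    congr 1
    ext x
    simp only [SmoothFn.add_apply, SmoothFn.sub_apply, SmoothFn.mul_apply, SmoothFn.smul_apply]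
    ring
  rw [splitGstar, h.hopfColeDensity_eq hinv hρ, signedEnergy, h1]
  change a⁻¹ * integ (ρ * firstVariation F ηs) + b / 2 = _
  rw [h2]
  ring

end

end HopfCole

end

/-! ### The convexity inequalities for both split energies -/

theorem mainTheorem3 {n : ℕ} {M : Type*} [TopologicalSpace M] [T2Space M] [CompactSpace M]
    [ChartedSpace (EuclideanSpace ℝ (Fin n)) M] [IsManifold (𝓡 n) ∞ M]
    [RiemannianBundle (fun x : M => TangentSpace (𝓡 n) x)]
    [IsContMDiffRiemannianBundle (𝓡 n) ∞ (EuclideanSpace ℝ (Fin n))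
      (fun x : M => TangentSpace (𝓡 n) x)]
    [MeasurableSpace M] [BorelSpace M]
    (D : Set (HopfCole.SmoothFn n M)) (F : HopfCole.SmoothFn n M → ℝ)
    (hF : HopfCole.IsSmoothFunctional D F)
    (hinv : InjOn (HopfCole.firstVariation F) D)
    (a b : ℝ) (ha : 0 < a) (hhom : HopfCole.IsHomogeneousWith a b F)
    (lam : ℝ) (hconv : HopfCole.IsWassersteinConvex lam F)
    (ρ S η ηs : ℝ → HopfCole.SmoothFn n M)
    (hflow : HopfCole.IsHamiltonianFlow F ρ S)
    (hη : ∀ t ∈ Icc (0 : ℝ) 1, η t ∈ D ∧ ηs t ∈ D ∧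
      HopfCole.IsHopfCole F (η t) (ηs t) (ρ t) (S t))
    (c : ℝ) (hc : c = (1 - a⁻¹) / 2) :
    ∃ Ham : ℝ, ∀ t ∈ Icc (0 : ℝ) 1,
      HopfCole.hamiltonian F (ρ t) (S t) = Ham ∧
      F (ρ t) = HopfCole.splitG D F a b (η t) (ηs t)
        + HopfCole.splitGstar D F a b (η t) (ηs t) ∧
      HopfCole.splitG D F a b (η t) (ηs t) + c * t * Ham
        ≤ HopfCole.alpha lam (1 - t) * HopfCole.splitG D F a b (η 0) (ηs 0)
          + (1 - HopfCole.alpha lam (1 - t))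
            * (HopfCole.splitG D F a b (η 1) (ηs 1) + c * Ham) ∧
      HopfCole.splitGstar D F a b (η t) (ηs t) - c * t * Ham
        ≤ (1 - HopfCole.alpha lam t) * HopfCole.splitGstar D F a b (η 0) (ηs 0)
          + HopfCole.alpha lam t
            * (HopfCole.splitGstar D F a b (η 1) (ηs 1) - c * Ham) := by
  subst hc
  have := HopfCole.isFiniteMeasure_riemVolume (hflow.mem_densities 0 ⟨le_rfl, zero_le_one⟩)
  obtain ⟨Ham, hHam⟩ := hflow.exists_hamiltonian_eq hF
  have hD : ∀ t ∈ Icc (0 : ℝ) 1, ρ t ∈ D := fun t ht =>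
    hF.pos_mem _ (hflow.mem_densities t ht).1
  have hG : ∀ t ∈ Icc (0 : ℝ) 1, HopfCole.splitG D F a b (η t) (ηs t)
      = HopfCole.signedEnergy F a 1 (ρ t) (S t) := fun t ht =>
    (hη t ht).2.2.splitG_eq hinv (hD t ht) (hflow.mem_densities t ht) hhom
  have hGs : ∀ t ∈ Icc (0 : ℝ) 1, HopfCole.splitGstar D F a b (η t) (ηs t)
      = HopfCole.signedEnergy F a (-1) (ρ t) (S t) := fun t ht =>
    (hη t ht).2.2.splitGstar_eq hinv (hD t ht) (hflow.mem_densities t ht) hhom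
  have h0 : (0 : ℝ) ∈ Icc (0 : ℝ) 1 := ⟨le_rfl, zero_le_one⟩
  have h1 : (1 : ℝ) ∈ Icc (0 : ℝ) 1 := ⟨zero_le_one, le_rfl⟩
  have hpos : ∀ κ, 0 < HopfCole.expPrimitive κ 1 := fun κ => by
    simpa using HopfCole.strictMono_expPrimitive κ one_pos
  refine ⟨Ham, fun t ht => ⟨hHam t ht, ?_, ?_, ?_⟩⟩
  · rw [hG t ht, hGs t ht, HopfCole.signedEnergy, HopfCole.signedEnergy]
    ring
  · have h := hflow.signedEnergy_convex (σ := 1) hF ha.ne' hhom hconv (by norm_num) hHam ht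
    -- The weight `α_{1-t}` is written as `1 - (1 - α_{1-t})`, so that both weights become ratios of
    -- `expPrimitive`; its positive value at `1` is then cleared.
    rw [hG t ht, hG 0 h0, hG 1 h1, HopfCole.alpha_one_sub_eq_div,
      ← sub_sub_cancel 1 (HopfCole.alpha lam (1 - t)), HopfCole.alpha_one_sub_eq_div]
    rw [mul_one] at h
    have hp := hpos (2 * lam)
    refine le_of_mul_le_mul_left (h.trans_eq' ?_ |>.trans_eq ?_) hp
    · ring
    · field_simp
  · have h := hflow.signedEnergy_convex (σ := -1) hF ha.ne' hhom hconv (by norm_num) hHam ht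
    rw [hGs t ht, hGs 0 h0, hGs 1 h1, HopfCole.alpha_eq_div]
    rw [show 2 * lam * -1 = -2 * lam by ring] at h
    generalize -2 * lam = κ at h ⊢
    have hp := hpos κ
    refine le_of_mul_le_mul_left (h.trans_eq' ?_ |>.trans_eq ?_) hp
    · ring
    · field_simp
      ring
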